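/- **Supersonic pulses are nonlinearly convectively stable.** *Setting.* Let $\mathcal N$ be a saturable nonlinearity: $\mathcal N$ is smooth on $[0,\infty)$, $\mathcal N'(s)<0$ for $s>0$, $\mathcal N(0)=1$, $\mathcal N(1)=0$, $\mathcal N(s)\to\mathcal N_\infty\in(-\infty,0)$ as $s\to\infty$, and $\mathcal N^{(k)}(s)\to0$ as $s\to\infty$ for every $k\ge1$, with $\mathcal N'(s)=O(1/s)$. Consider the system $$u_t=v_y+\mathcal N(u^2+v^2)\,v,\qquad v_t=u_y-\mathcal N(u^2+v^2)\,u .$$ Let $b_*=(u_*,v_*)$ be a supersonic pulse of speed $c>1$, that is, a solution on $\mathbb R$ of $$u_*'=\frac{\mathcal N(|b_*|^2)}{1-c^2}(u_*+cv_*),\qquad v_*'=\frac{\mathcal N(|b_*|^2)}{1-c^2}(-cu_*-v_*)$$ whose limits at $-\infty$ and $+\infty$ are two distinct points of the unit circle; then $b_*(y-ct)$ solves the system. For $a,w\in\mathbb R^2$ put $$G(a,w)=\begin{bmatrix}\mathcal N(|a+w|^2)w_2+[\mathcal N(|a+w|^2)-\mathcal N(|a|^2)]a_2\\-\mathcal N(|a+w|^2)w_1-[\mathcal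 N(|a+w|^2)-\mathcal N(|a|^2)]a_1\end{bmatrix}.$$ The perturbation $B=(U,V)$ of the pulse satisfies, in the comoving frame $x=y-ct$, $$B_t=\begin{bmatrix}c&1\\1&c\end{bmatrix}B_x+G\big(b_*(x),B\big),\qquad B(\cdot,0)=B_0,\tag{1}$$ and in the lab frame $$B_t=\begin{bmatrix}0&1\\1&0\end{bmatrix}B_y+G\big(b_*(y-ct),B\big),\qquad B(\cdot,0)=B_0.\tag{2}$$ Solutions are mild solutions (solutions of Duhamel's formula) in $C([0,\infty);H^1(\mathbb R;\mathbb R^2))$, and $\|f\|_{H^1(I)}^2=\int_I|f|^2+\int_I|f'|^2$. Call $\gamma_0>0$ an *$H^1$ growth exponent* if there is a constant $C$ such that $\|B(\cdot,t)\|_{H^1(\mathbb R)}\le C e^{\gamma_0t}\|B_0\|_{H^1(\mathbb R)}$ for all $t\ge0$, all $B_0\in H^1(\mathbb R)$ and the corresponding solutions $B$ of (1). *Claim.* 1. For every $B_0\in H^1(\mathbb R)$, (1) has a unique global mild solution. 2. The two formulations are equivalent: $B(x,t)$ is a mild solution of (1) if and only if $B(y-ct,t)$ is a mild solution of (2) with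 the same initial data, and then the $H^1([R+ct,\infty))$ norm of $y\mapsto B(y-ct,t)$ equals the $H^1([R,\infty))$ norm of $B(\cdot,t)$, for every $R\in\mathbb R$. 3. An $H^1$ growth exponent $\gamma_0>0$, depending only on $\mathcal N$ and $b_*$ (with its speed $c$), exists. 4. Let $\gamma_0>0$ be any $H^1$ growth exponent, let $\gamma>\gamma_0/(c-1)$, and let $B_0\in H^1(\mathbb R)$ satisfy $\|B_0\|_{H^1([\ell,\infty))}=o(e^{-\gamma\ell})$ as $\ell\to\infty$. Then, for every $R\in\mathbb R$, as $t\to\infty$: the solution of (2) satisfies $$\|B(\cdot,t)\|_{H^1([R+ct,\infty))}=O\big(e^{-(\gamma(c-1)-\gamma_0)t}\big),$$ and the solution of (1) satisfies $$\|B(\cdot,t)\|_{H^1([R,\infty))}=O\big(e^{-(\gamma(c-1)-\gamma_0)t}\big).$$ -/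

import Mathlib

open Set Filter Topology MeasureTheory Asymptotics
open scoped ContDiff

noncomputable section

namespace ConvectiveStability

/-- Values of the unknowns `(u, v)`, with the Euclidean norm `‖b‖ ^ 2 = u ^ 2 + v ^ 2`. -/
abbrev Vec : Type := EuclideanSpace ℝ (Fin 2)

/-- A saturable nonlinearity: `N` is smooth on `[0, ∞)`, `N' < 0` on `(0, ∞)`, `N 0 = 1`,
`N 1 = 0`, `N s` has a finite negative limit as `s → ∞`, and all derivatives of `N` tend to zero
at infinity, the first one at least as fast as `1 / s`. -/
structure IsSaturable (N : ℝ → ℝ) : Prop where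
  smooth : ContDiffOn ℝ ∞ N (Ici 0)
  deriv_neg : ∀ s : ℝ, 0 < s → deriv N s < 0
  map_zero : N 0 = 1
  map_one : N 1 = 0
  limit : ∃ Ninf : ℝ, Ninf < 0 ∧ Tendsto N atTop (𝓝 Ninf)
  deriv_tendsto : ∀ k : ℕ, 1 ≤ k → Tendsto (iteratedDeriv k N) atTop (𝓝 0)
  deriv_decay : deriv N =O[atTop] fun s : ℝ => s⁻¹

/-- `b` is the profile of a travelling pulse of speed `c` (`c ≠ ±1`) of
`u_t = v_y + N (u ^ 2 + v ^ 2) v`, `v_t = u_y - N (u ^ 2 + v ^ 2) u`: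
an orbit of the profile equations
`u' = N (u ^ 2 + v ^ 2) / (1 - c ^ 2) * (u + c v)`,
`v' = N (u ^ 2 + v ^ 2) / (1 - c ^ 2) * (- c u - v)`
which connects two distinct equilibria on the unit circle. -/
structure IsPulse (N : ℝ → ℝ) (c : ℝ) (b : ℝ → Vec) : Prop where
  profile : ∀ x : ℝ,
    HasDerivAt b ((N (‖b x‖ ^ 2) / (1 - c ^ 2)) • !₂[b x 0 + c * b x 1, -c * b x 0 - b x 1]) x
  heteroclinic : ∃ bm bp : Vec, ‖bm‖ = 1 ∧ ‖bp‖ = 1 ∧ bm ≠ bp ∧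
    Tendsto b atBot (𝓝 bm) ∧ Tendsto b atTop (𝓝 bp)

/-- A supersonic pulse: a pulse whose speed satisfies `|c| > 1`. -/
structure IsSupersonicPulse (N : ℝ → ℝ) (c : ℝ) (b : ℝ → Vec) : Prop extends IsPulse N c b where
  supersonic : 1 < |c|

/-- `f ∈ H¹(ℝ; ℝ²)`. On the line, the elements of `H¹` are (in their continuous representatives)
the square integrable functions which are the integral of their almost everywhere derivative, that
derivative being square integrable as well; the latter is then the weak derivative. -/
structure MemH1 (f : ℝ → Vec) : Prop where
  memLp : MemLp f 2 volume
  memLp_deriv : MemLp (deriv f) 2 volume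
  integral_deriv : ∀ a b : ℝ, f b - f a = ∫ x in a..b, deriv f x

/-- The `H¹` norm on a set `S` (used for the line and for half-lines):
`‖f‖ ^ 2 = ∫_S |f| ^ 2 + ∫_S |f'| ^ 2`. -/
def h1Norm (S : Set ℝ) (f : ℝ → Vec) : ℝ :=
  Real.sqrt ((∫ x in S, ‖f x‖ ^ 2) + ∫ x in S, ‖deriv f x‖ ^ 2)

/-- The group `T_c(t) = exp (t Σ ∂ₓ)`, `Σ = !![c, 1; 1, c]`. In the eigenbasis `(1, 1)`, `(1, -1)`
of `Σ`, with eigenvalues `c + 1` and `c - 1`, it acts by translations. -/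
def transport (c t : ℝ) (f : ℝ → Vec) (x : ℝ) : Vec :=
  ((f (x + (c + 1) * t) 0 + f (x + (c + 1) * t) 1) / 2) • !₂[(1 : ℝ), 1] +
    ((f (x + (c - 1) * t) 0 - f (x + (c - 1) * t) 1) / 2) • !₂[(1 : ℝ), -1]

/-- `T_c(0)` is the identity. -/
theorem transport_zero (c : ℝ) (f : ℝ → Vec) : transport c 0 f = f := by
  funext x
  ext i
  fin_cases i <;> simp [transport] <;> ring

/-- `T_c` is a one-parameter group. -/
theorem transport_add (c s t : ℝ) (f : ℝ → Vec) :
    transport c (s + t) f = transport c s (transport c t f) := by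
  funext x
  have h1 : x + (c + 1) * s + (c + 1) * t = x + (c + 1) * (s + t) := by ring
  have h2 : x + (c - 1) * s + (c - 1) * t = x + (c - 1) * (s + t) := by ring
  ext i
  fin_cases i <;> simp [transport, h1, h2] <;> ring

/-- On differentiable `f`, the generator of `T_c` at time zero is `Σ ∂ₓ`. -/
theorem transport_hasDerivAt_zero (c : ℝ) (f : ℝ → Vec) (x : ℝ) (f' : Vec)
    (hf : HasDerivAt f f' x) :
    HasDerivAt (fun t => transport c t f x) !₂[c * f' 0 + f' 1, f' 0 + c * f' 1] 0 := by
  have hp : ∀ (a : ℝ) (i : Fin 2), HasDerivAt (fun t : ℝ => f (x + a * t) i) (a * f' i) 0 := by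
    intro a i
    have h0 : HasDerivAt (fun z => f z i) (f' i) (x + a * 0) := by
      have h := (EuclideanSpace.proj (𝕜 := ℝ) i).hasFDerivAt.comp_hasDerivAt x hf
      rw [mul_zero, add_zero]
      exact h
    have h1 : HasDerivAt (fun t : ℝ => x + a * t) a 0 := by
      simpa using ((hasDerivAt_id (0 : ℝ)).const_mul a).const_add x
    simpa [Function.comp_def, mul_comm] using h0.comp (0 : ℝ) h1
  have h := ((((hp (c + 1) 0).add (hp (c + 1) 1)).div_const 2).smul_const !₂[(1 : ℝ), 1]).add
    ((((hp (c - 1) 0).sub (hp (c - 1) 1)).div_const 2).smul_const !₂[(1 : ℝ), -1])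
  refine h.congr_deriv ?_
  ext i
  fin_cases i <;> simp <;> ring

/-- The nonlinear term of the equation for the perturbation `w = (U, V)` of a state
`a = (u_*, v_*)`:
`(N(|a + w|²) V + [N(|a + w|²) - N(|a|²)] v_*, - N(|a + w|²) U - [N(|a + w|²) - N(|a|²)] u_*)`. -/
def pertNonlin (N : ℝ → ℝ) (a w : Vec) : Vec :=
  !₂[N (‖a + w‖ ^ 2) * w 1 + (N (‖a + w‖ ^ 2) - N (‖a‖ ^ 2)) * a 1,
    -(N (‖a + w‖ ^ 2) * w 0) - (N (‖a + w‖ ^ 2) - N (‖a‖ ^ 2)) * a 0]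

/-- Global mild solution in `C([0, ∞), H¹(ℝ))` of `B_t = Σ B_x + F(t, x, B)`, `B(·, 0) = B₀`, with
`Σ = !![c, 1; 1, c]`. Here `B t x` is the value at time `t` and position `x`; only `t ≥ 0` matters.
For the continuous representatives used here the `H¹`-valued integral in Duhamel's formula is
computed pointwise in `x`. -/
structure IsMildSolution (c : ℝ) (F : ℝ → ℝ → Vec → Vec) (B₀ : ℝ → Vec) (B : ℝ → ℝ → Vec) :
    Prop where
  memH1 : ∀ t : ℝ, 0 ≤ t → MemH1 (B t)
  continuous_H1 : ∀ t₀ : ℝ, 0 ≤ t₀ →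
    Tendsto (fun t => h1Norm univ (fun x => B t x - B t₀ x)) (𝓝[Ici 0] t₀) (𝓝 0)
  duhamel : ∀ t : ℝ, 0 ≤ t → ∀ x : ℝ,
    B t x = transport c t B₀ x + ∫ s in (0 : ℝ)..t, transport c (t - s) (fun z => F s z (B s z)) x

/-- The perturbation equation in the frame `x = y - c t` comoving with the pulse `b`:
`U_t = c U_x + V_x + …`, `V_t = U_x + c V_x + …`. -/
def IsComovingSolution (N : ℝ → ℝ) (c : ℝ) (b : ℝ → Vec) (B₀ : ℝ → Vec) (B : ℝ → ℝ → Vec) : Prop :=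
  IsMildSolution c (fun _ x w => pertNonlin N (b x) w) B₀ B

/-- The perturbation equation in the lab frame, where the pulse is `b (y - c t)`:
`U_t = V_y + …`, `V_t = U_y + …`. -/
def IsLabSolution (N : ℝ → ℝ) (c : ℝ) (b : ℝ → Vec) (B₀ : ℝ → Vec) (B : ℝ → ℝ → Vec) : Prop :=
  IsMildSolution 0 (fun t y w => pertNonlin N (b (y - c * t)) w) B₀ B

/-- `γ₀` is an exponent for the growth of the `H¹` norm of perturbations of `b`:
`‖B(·, t)‖ ≤ C e^{γ₀ t} ‖B₀‖` for all initial data in `H¹(ℝ)`, with one constant `C`. -/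
def IsH1GrowthExponent (N : ℝ → ℝ) (c : ℝ) (b : ℝ → Vec) (γ₀ : ℝ) : Prop :=
  ∃ C : ℝ, ∀ (B₀ : ℝ → Vec) (B : ℝ → ℝ → Vec), MemH1 B₀ → IsComovingSolution N c b B₀ B →
    ∀ t : ℝ, 0 ≤ t → h1Norm univ (B t) ≤ C * Real.exp (γ₀ * t) * h1Norm univ B₀

end ConvectiveStability

end

/-! In the comoving frame both characteristics of the linear part run to the left when `c > 1`, with
speeds `c + 1` and `c - 1`. Hence the solution on `[R, ∞)` at time `t` is determined by the data on
`[R + (c - 1) t, ∞)` (`IsComovingSolution.eq_of_eq_on_Ici`). Reflecting the data evenly about the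
left end of that half-line gives new `H¹` data with the same solution on `[R, ∞)` and with norm at
most `√2` times the norm on the half-line (`MemH1.exists_extension`). Any growth exponent, applied
to the new solution, bounds the norm on `[R, ∞)` by a multiple of `e^{γ₀ t} e^{-γ (R + (c - 1) t)}`,
which is the claimed rate.

For well-posedness, write the nonlinear term as `F (b + w) - F b` with `F z = N (|z|²) J z` and `J`
a rotation. Boundedness of `N` and `N' (s) = O(1 / s)` at infinity make `F` globally Lipschitz. On
`H¹` the nonlinear term therefore has linear growth, and it is Lipschitz on balls. Since the
transport group `T` is bounded on `H¹`, the unknown `v = T (-t) u` solves an ordinary differential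
equation in `H¹` of the same kind. Picard-Lindelöf with a uniform time step gives a global solution,
and Grönwall's inequality gives a growth exponent. Uniqueness is a case of the domain of dependence,
proved by iterating Duhamel's formula pointwise. -/

noncomputable section

namespace ConvectiveStability

/-! ### Absolutely continuous functions as primitives -/

section Primitive

variable {E F : Type*} [NormedAddCommGroup E] [NormedSpace ℝ E] [NormedAddCommGroup F]
  [NormedSpace ℝ F]

theorem locallyIntegrable_norm {E : Type*} [NormedAddCommGroup E] {g : ℝ → E}
    (hg : LocallyIntegrable g) : LocallyIntegrable fun x => ‖g x‖ := fun x =>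
  let ⟨s, hs, hi⟩ := hg x
  ⟨s, hs, hi.norm⟩

theorem intervalIntegrable_of_locallyIntegrable {E : Type*} [NormedAddCommGroup E] {g : ℝ → E}
    (hg : LocallyIntegrable g) (a b : ℝ) :
    IntervalIntegrable g volume a b :=
  intervalIntegrable_iff.mpr
    ((hg.integrableOn_isCompact isCompact_uIcc).mono_set uIoc_subset_uIcc)

/-- `f` is a primitive of the locally integrable function `g`, that is, `f` is locally absolutely
continuous with almost everywhere derivative `g`. -/
structure IsPrimitive (f g : ℝ → E) : Prop where
  locInt : LocallyIntegrable g
  sub_eq : ∀ a b : ℝ, f b - f a = ∫ x in a..b, g x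

namespace IsPrimitive

variable {f g f₁ g₁ : ℝ → E}

theorem intervalIntegrable (h : IsPrimitive f g) (a b : ℝ) : IntervalIntegrable g volume a b :=
  intervalIntegrable_of_locallyIntegrable h.locInt a b

theorem of_zero (hg : LocallyIntegrable g) (h : ∀ x : ℝ, f x - f 0 = ∫ y in (0 : ℝ)..x, g y) :
    IsPrimitive f g := by
  refine ⟨hg, fun a b => ?_⟩
  have hi := intervalIntegrable_of_locallyIntegrable hg
  rw [← intervalIntegral.integral_interval_sub_left (hi 0 b) (hi 0 a), ← h a, ← h b]
  abel

theorem congr_ae (h : IsPrimitive f g) (hg : g =ᵐ[volume] g₁) : IsPrimitive f g₁ :=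
  ⟨h.locInt.congr hg, fun a b => (h.sub_eq a b).trans
    (intervalIntegral.integral_congr_ae (hg.mono fun _ hx _ => hx))⟩

theorem of_hasDerivAt [CompleteSpace E] (h : ∀ x, HasDerivAt f (g x) x) (hg : Continuous g) :
    IsPrimitive f g :=
  ⟨hg.locallyIntegrable, fun a b => (intervalIntegral.integral_eq_sub_of_hasDerivAt
    (fun x _ => h x) (hg.intervalIntegrable a b)).symm⟩

theorem continuous (h : IsPrimitive f g) : Continuous f := by
  have h0 : f = fun x => f 0 + ∫ y in (0 : ℝ)..x, g y := by
    funext x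
    rw [← h.sub_eq 0 x]
    abel
  rw [h0]
  exact continuous_const.add (intervalIntegral.continuous_primitive h.intervalIntegrable 0)

theorem ae_hasDerivAt [CompleteSpace E] (h : IsPrimitive f g) :
    ∀ᵐ x : ℝ, HasDerivAt f (g x) x := by
  filter_upwards [_root_.LocallyIntegrable.ae_hasDerivAt_integral h.locInt] with x hx
  have h0 : f = fun x => f 0 + ∫ y in (0 : ℝ)..x, g y := by
    funext x
    rw [← h.sub_eq 0 x]
    abel
  rw [h0]
  exact (hx 0).const_add _

theorem deriv_ae_eq [CompleteSpace E] (h : IsPrimitive f g) : deriv f =ᵐ[volume] g :=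
  h.ae_hasDerivAt.mono fun _ hx => hx.deriv

theorem add (h : IsPrimitive f g) (h₁ : IsPrimitive f₁ g₁) :
    IsPrimitive (fun x => f x + f₁ x) (fun x => g x + g₁ x) := by
  refine ⟨h.locInt.add h₁.locInt, fun a b => ?_⟩
  rw [intervalIntegral.integral_add (h.intervalIntegrable a b) (h₁.intervalIntegrable a b),
    ← h.sub_eq, ← h₁.sub_eq]
  abel

theorem sub (h : IsPrimitive f g) (h₁ : IsPrimitive f₁ g₁) :
    IsPrimitive (fun x => f x - f₁ x) (fun x => g x - g₁ x) := by
  refine ⟨h.locInt.sub h₁.locInt, fun a b => ?_⟩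
  rw [intervalIntegral.integral_sub (h.intervalIntegrable a b) (h₁.intervalIntegrable a b),
    ← h.sub_eq, ← h₁.sub_eq]
  abel

theorem clm_comp [CompleteSpace E] [CompleteSpace F] (h : IsPrimitive f g) (A : E →L[ℝ] F) :
    IsPrimitive (fun x => A (f x)) (fun x => A (g x)) := by
  refine ⟨fun x => ?_, fun a b => ?_⟩
  · obtain ⟨s, hs, hi⟩ := h.locInt x
    exact ⟨s, hs, A.integrable_comp hi⟩
  · rw [ContinuousLinearMap.intervalIntegral_comp_comm A (h.intervalIntegrable a b), ← h.sub_eq,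
      map_sub]

theorem comp_add_right (h : IsPrimitive f g) (k : ℝ) :
    IsPrimitive (fun x => f (x + k)) (fun x => g (x + k)) := by
  refine ⟨fun x => ?_, fun a b => ?_⟩
  · obtain ⟨s, hs, hi⟩ := h.locInt (x + k)
    refine ⟨(fun x => x + k) ⁻¹' s, (continuous_add_const k).continuousAt.preimage_mem_nhds hs, ?_⟩
    exact ((measurePreserving_add_right volume k).integrableOn_comp_preimage
      (Homeomorph.addRight k).measurableEmbedding).mpr hi
  · rw [intervalIntegral.integral_comp_add_right, h.sub_eq]

/-- A function whose increments are dominated by integrals of a locally integrable function is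
absolutely continuous. -/
theorem absolutelyContinuous_of_le {E : Type*} [NormedAddCommGroup E] {φ : ℝ → E} {m : ℝ → ℝ}
    (hm : LocallyIntegrable m)
    (hφ : ∀ a b : ℝ, a ≤ b → ‖φ b - φ a‖ ≤ ∫ x in a..b, m x) (a b : ℝ) :
    AbsolutelyContinuousOnInterval φ a b := by
  have hi := intervalIntegrable_of_locallyIntegrable hm
  have hM := (hi a b).absolutelyContinuousOnInterval_intervalIntegral (c := a) left_mem_uIcc
  rw [absolutelyContinuousOnInterval_iff] at hM ⊢
  intro ε hε
  obtain ⟨δ, hδ, H⟩ := hM ε hε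
  refine ⟨δ, hδ, fun I hI hI' => lt_of_le_of_lt (Finset.sum_le_sum fun i _ => ?_) (H I hI hI')⟩
  rw [Real.dist_eq, intervalIntegral.integral_interval_sub_left (hi _ _) (hi _ _), dist_eq_norm]
  -- The pairs in the definition of absolute continuity are unordered, while the hypothesis concerns
  -- ordered endpoints.
  rcases le_total (I.2 i).1 (I.2 i).2 with hle | hle
  · rw [norm_sub_rev, intervalIntegral.integral_symm, abs_neg]
    exact (hφ _ _ hle).trans (le_abs_self _)
  · exact (hφ _ _ hle).trans (le_abs_self _)

/-- Chain rule for the composition of a Lipschitz `C¹` map with an absolutely continuous curve. -/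
theorem comp_lipschitz [CompleteSpace E] [CompleteSpace F] {H : E → F} {L : NNReal}
    (h : IsPrimitive f g) (hH : ContDiff ℝ 1 H) (hL : LipschitzWith L H) :
    IsPrimitive (fun x => H (f x)) (fun x => fderiv ℝ H (f x) (g x)) := by
  have hc : Continuous fun x => fderiv ℝ H (f x) :=
    (hH.continuous_fderiv one_ne_zero).comp h.continuous
  have hnorm : ∀ x, ‖fderiv ℝ H (f x) (g x)‖ ≤ L * ‖g x‖ := fun x =>
    (ContinuousLinearMap.le_opNorm _ _).trans
      (mul_le_mul_of_nonneg_right (norm_fderiv_le_of_lipschitz ℝ hL) (norm_nonneg _))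
  have hm : LocallyIntegrable fun x => (L : ℝ) * ‖g x‖ :=
    (locallyIntegrable_norm h.locInt).smul (L : ℝ)
  have hl : LocallyIntegrable fun x => fderiv ℝ H (f x) (g x) := by
    refine hm.mono ?_ (Eventually.of_forall fun x => ?_)
    · exact (ContinuousLinearMap.apply ℝ F).flip.flip.aestronglyMeasurable_comp₂
        h.locInt.aestronglyMeasurable hc.aestronglyMeasurable
    · exact (hnorm x).trans (le_abs_self _)
  have hi := intervalIntegrable_of_locallyIntegrable hl
  have hmi := intervalIntegrable_of_locallyIntegrable hm
  refine ⟨hl, fun a b => ?_⟩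
  have hac1 := absolutelyContinuous_of_le (φ := fun x => H (f x)) hm (fun a b hab => by
    refine (hL.norm_sub_le _ _).trans ?_
    rw [h.sub_eq, intervalIntegral.integral_const_mul]
    exact mul_le_mul_of_nonneg_left (intervalIntegral.norm_integral_le_integral_norm hab)
      L.coe_nonneg) a b
  have hac2 := absolutelyContinuous_of_le
    (φ := fun x => ∫ y in a..x, fderiv ℝ H (f y) (g y)) hm (fun p q hpq => by
    rw [intervalIntegral.integral_interval_sub_left (hi _ _) (hi _ _)]
    exact intervalIntegral.norm_integral_le_of_norm_le hpq
      (Eventually.of_forall fun x _ => hnorm x) (hmi p q)) a b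
  -- `H ∘ f` and the integral of its expected derivative are absolutely continuous with the same
  -- derivative almost everywhere, so their difference is constant.
  obtain ⟨C, hC⟩ := (hac1.sub hac2).const_of_ae_hasDerivAt_zero (by
    filter_upwards [h.ae_hasDerivAt, _root_.LocallyIntegrable.ae_hasDerivAt_integral hl]
      with x hx hx' _
    have h1 := ((hH.differentiable one_ne_zero (f x)).hasFDerivAt.comp_hasDerivAt x hx).sub (hx' a)
    rw [sub_self] at h1
    exact h1)
  have h1 := hC a left_mem_uIcc
  have h2 := (hC b right_mem_uIcc).trans h1.symm
  simp only [Pi.sub_apply, intervalIntegral.integral_same, sub_zero] at h2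
  rw [← h2]
  abel

/-- The even reflection of an absolutely continuous function. -/
theorem comp_abs (h : IsPrimitive f g) :
    IsPrimitive (fun x => f |x|) (fun x => if 0 ≤ x then g x else -g (-x)) := by
  have hneg : LocallyIntegrable fun x => g (-x) := by
    intro x
    obtain ⟨s, hs, hi⟩ := h.locInt (-x)
    refine ⟨Neg.neg ⁻¹' s, continuous_neg.continuousAt.preimage_mem_nhds hs, ?_⟩
    exact ((Measure.measurePreserving_neg volume).integrableOn_comp_preimage
      (Homeomorph.neg ℝ).measurableEmbedding).mpr hi
  refine of_zero ?_ fun x => ?_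
  · have h2 : LocallyIntegrable fun x => ‖g x‖ + ‖g (-x)‖ :=
      (locallyIntegrable_norm h.locInt).add (locallyIntegrable_norm hneg)
    have hmeas := AEStronglyMeasurable.piecewise (s := {x : ℝ | 0 ≤ x}) (μ := volume)
      measurableSet_Ici h.locInt.aestronglyMeasurable.restrict
      hneg.aestronglyMeasurable.neg.restrict
    refine h2.mono hmeas (Eventually.of_forall fun x => ?_)
    have p1 := norm_nonneg (g x)
    have p2 := norm_nonneg (g (-x))
    rw [Real.norm_of_nonneg (by positivity)]
    split_ifs
    · linarith
    · rw [norm_neg]; linarith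
  · rcases le_total 0 x with hx | hx
    · rw [abs_zero, abs_of_nonneg hx, h.sub_eq]
      refine intervalIntegral.integral_congr fun y hy => ?_
      rw [uIcc_of_le hx] at hy
      exact (if_pos hy.1).symm
    · have h1 : ∫ y in (0 : ℝ)..x, (if 0 ≤ y then g y else -g (-y)) =
          ∫ y in (0 : ℝ)..x, -g (-y) := by
        refine intervalIntegral.integral_congr_ae ?_
        filter_upwards [(measure_singleton (0 : ℝ) : volume {(0 : ℝ)} = 0) |> compl_mem_ae_iff.mpr]
          with y hy hy'
        rw [uIoc_of_ge hx] at hy'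
        exact if_neg fun h0 => hy (le_antisymm hy'.2 h0)
      rw [h1, abs_zero, abs_of_nonpos hx, h.sub_eq, intervalIntegral.integral_neg,
        intervalIntegral.integral_comp_neg, neg_zero, ← intervalIntegral.integral_symm]

end IsPrimitive

end Primitive

/-! ### Stability properties of `H¹` functions -/

section MemH1

theorem MemH1.isPrimitive {f : ℝ → Vec} (h : MemH1 f) : IsPrimitive f (deriv f) :=
  ⟨h.memLp_deriv.locallyIntegrable one_le_two, h.integral_deriv⟩

/-- By Lebesgue differentiation the pointwise `deriv f` agrees almost everywhere with any `g` of
which `f` is a primitive. Membership in `H¹` is always checked through such an explicit `g`. -/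
theorem IsPrimitive.memH1 {f g : ℝ → Vec} (h : IsPrimitive f g) (hf : MemLp f 2 volume)
    (hg : MemLp g 2 volume) : MemH1 f :=
  ⟨hf, hg.ae_eq h.deriv_ae_eq.symm, (h.congr_ae h.deriv_ae_eq.symm).sub_eq⟩

theorem MemH1.continuous {f : ℝ → Vec} (h : MemH1 f) : Continuous f := h.isPrimitive.continuous

theorem MemH1.add {f g : ℝ → Vec} (hf : MemH1 f) (hg : MemH1 g) : MemH1 (fun x => f x + g x) :=
  (hf.isPrimitive.add hg.isPrimitive).memH1 (hf.memLp.add hg.memLp)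
    (hf.memLp_deriv.add hg.memLp_deriv)

/-- Translation followed by a linear map of the values. -/
theorem MemH1.clm_comp_add_right {f : ℝ → Vec} (hf : MemH1 f) (A : Vec →L[ℝ] Vec) (k : ℝ) :
    MemH1 (fun x => A (f (x + k))) :=
  ((hf.isPrimitive.comp_add_right k).clm_comp A).memH1
    (A.comp_memLp' (hf.memLp.comp_measurePreserving (measurePreserving_add_right volume k)))
    (A.comp_memLp' (hf.memLp_deriv.comp_measurePreserving (measurePreserving_add_right volume k)))

theorem MemH1.deriv_clm_comp_add_right {f : ℝ → Vec} (hf : MemH1 f) (A : Vec →L[ℝ] Vec) (k : ℝ) :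
    deriv (fun x => A (f (x + k))) =ᵐ[volume] fun x => A (deriv f (x + k)) :=
  ((hf.isPrimitive.comp_add_right k).clm_comp A).deriv_ae_eq

end MemH1

/-! ### `L²` estimates and the Sobolev embedding -/

section L2Norm

/-- The `L²` norm on the line. -/
def l2Norm (f : ℝ → Vec) : ℝ := (eLpNorm f 2 volume).toReal

theorem l2Norm_nonneg (f : ℝ → Vec) : 0 ≤ l2Norm f := ENNReal.toReal_nonneg

theorem l2Norm_congr {f g : ℝ → Vec} (h : f =ᵐ[volume] g) : l2Norm f = l2Norm g := by
  rw [l2Norm, l2Norm, eLpNorm_congr_ae h]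

theorem l2Norm_sq {f : ℝ → Vec} (hf : MemLp f 2 volume) : l2Norm f ^ 2 = ∫ x, ‖f x‖ ^ 2 := by
  have h0 : 0 ≤ ∫ x, ‖f x‖ ^ (2 : ENNReal).toReal := integral_nonneg fun x => by positivity
  rw [l2Norm, hf.eLpNorm_eq_integral_rpow_norm two_ne_zero ENNReal.ofNat_ne_top,
    ENNReal.toReal_ofReal (by positivity), ← Real.rpow_natCast, ← Real.rpow_mul h0]
  simp

theorem l2Norm_comp_add_right {f : ℝ → Vec} (hf : MemLp f 2 volume) (k : ℝ) :
    l2Norm (fun x => f (x + k)) = l2Norm f := by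
  rw [l2Norm, l2Norm, ← eLpNorm_comp_measurePreserving hf.aestronglyMeasurable
    (measurePreserving_add_right volume k)]
  rfl

/-- A function dominated by a linear combination of `L²` functions is in `L²`. -/
theorem memLp_of_le_linear {h f₁ f₂ f₃ : ℝ → Vec} {p q r : ℝ} (hp : 0 ≤ p) (hq : 0 ≤ q)
    (hr : 0 ≤ r) (hh : AEStronglyMeasurable h volume) (h₁ : MemLp f₁ 2 volume)
    (h₂ : MemLp f₂ 2 volume) (h₃ : MemLp f₃ 2 volume)
    (hle : ∀ᵐ x, ‖h x‖ ≤ p * ‖f₁ x‖ + q * ‖f₂ x‖ + r * ‖f₃ x‖) :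
    MemLp h 2 volume ∧ l2Norm h ≤ p * l2Norm f₁ + q * l2Norm f₂ + r * l2Norm f₃ := by
  have m₁ := h₁.norm.const_mul p
  have m₂ := h₂.norm.const_mul q
  have m₃ := h₃.norm.const_mul r
  have m := (m₁.add m₂).add m₃
  have hle' : ∀ᵐ x, ‖h x‖ ≤ ‖((fun x => p * ‖f₁ x‖) + (fun x => q * ‖f₂ x‖) +
      fun x => r * ‖f₃ x‖) x‖ := hle.mono fun x hx => hx.trans (le_abs_self _)
  have hc : ∀ (a : ℝ) (f : ℝ → Vec), 0 ≤ a →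
      (eLpNorm (fun x => a * ‖f x‖) 2 volume).toReal = a * l2Norm f := by
    intro a f ha
    have := eLpNorm_const_smul a (fun x => ‖f x‖) 2 (volume : Measure ℝ)
    rw [eLpNorm_norm] at this
    rw [l2Norm, show (fun x => a * ‖f x‖) = a • fun x => ‖f x‖ from rfl, this, ENNReal.toReal_mul]
    simp [abs_of_nonneg ha]
  refine ⟨m.mono hh hle', ?_⟩
  rw [← hc p f₁ hp, ← hc q f₂ hq, ← hc r f₃ hr, ← ENNReal.toReal_add m₁.2.ne m₂.2.ne,
    ← ENNReal.toReal_add (ENNReal.add_ne_top.mpr ⟨m₁.2.ne, m₂.2.ne⟩) m₃.2.ne]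
  refine ENNReal.toReal_mono (by finiteness) ((eLpNorm_mono_ae hle').trans ?_)
  refine (eLpNorm_add_le (m₁.add m₂).1 m₃.1 one_le_two).trans ?_
  gcongr
  exact eLpNorm_add_le m₁.1 m₂.1 one_le_two

/-- On bounded intervals the `L¹` norm is controlled by the `L²` norm. -/
theorem setIntegral_norm_le_l2Norm {g : ℝ → Vec} (hg : MemLp g 2 volume) {a b : ℝ} (hab : a ≤ b) :
    ∫ x in a..b, ‖g x‖ ≤ l2Norm g * (b - a) ^ (1 / 2 : ℝ) := by
  have h1 := eLpNorm_le_eLpNorm_mul_rpow_measure_univ (μ := volume.restrict (Ioc a b))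
    (one_le_two : (1 : ENNReal) ≤ 2) hg.aestronglyMeasurable.restrict
  have h2 : eLpNorm g 2 (volume.restrict (Ioc a b)) ≤ eLpNorm g 2 volume :=
    eLpNorm_mono_measure g Measure.restrict_le_self
  rw [Measure.restrict_apply_univ, Real.volume_Ioc, ENNReal.toReal_one, ENNReal.toReal_ofNat,
    ENNReal.ofReal_rpow_of_nonneg (sub_nonneg.mpr hab) (by norm_num)] at h1
  rw [intervalIntegral.integral_of_le hab, integral_norm_eq_lintegral_enorm
    hg.aestronglyMeasurable.restrict, ← eLpNorm_one_eq_lintegral_enorm]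
  have h3 := ENNReal.toReal_mono (ENNReal.mul_ne_top hg.2.ne ENNReal.ofReal_ne_top)
    (h1.trans (mul_le_mul_left h2 _))
  rw [ENNReal.toReal_mul, ENNReal.toReal_ofReal (Real.rpow_nonneg (sub_nonneg.mpr hab) _)] at h3
  refine h3.trans_eq ?_
  rw [l2Norm]
  norm_num

/-- The Sobolev embedding `H¹(ℝ) ⊆ L^∞(ℝ)`. -/
theorem MemH1.norm_apply_le {f : ℝ → Vec} (hf : MemH1 f) (x : ℝ) :
    ‖f x‖ ≤ l2Norm f + l2Norm (deriv f) := by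
  have hx : x ≤ x + 1 := by linarith
  have h1 := setIntegral_norm_le_l2Norm hf.memLp hx
  have h2 := setIntegral_norm_le_l2Norm hf.memLp_deriv hx
  rw [add_sub_cancel_left, Real.one_rpow, mul_one] at h1 h2
  have hi := hf.isPrimitive.intervalIntegrable
  have hfi : IntervalIntegrable (fun y => ‖f y‖) volume x (x + 1) :=
    hf.continuous.norm.intervalIntegrable _ _
  -- Compare `f x` with `f y` on an interval of length one, then average over `y`; both `L¹` norms
  -- there are at most the `L²` norms.
  have h3 : ∀ y ∈ Icc x (x + 1), ‖f x‖ ≤ ‖f y‖ + ∫ z in x..(x + 1), ‖deriv f z‖ := by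
    intro y hy
    have h4 : ‖f y - f x‖ ≤ ∫ z in x..y, ‖deriv f z‖ := by
      rw [hf.integral_deriv]
      exact intervalIntegral.norm_integral_le_integral_norm hy.1
    have h5 : ∫ z in x..y, ‖deriv f z‖ ≤ ∫ z in x..(x + 1), ‖deriv f z‖ :=
      intervalIntegral.integral_mono_interval le_rfl hy.1 hy.2
        (Eventually.of_forall fun z => norm_nonneg _) (hi _ _).norm
    have h6 : ‖f x‖ ≤ ‖f y‖ + ‖f y - f x‖ := by
      rw [← norm_sub_rev]
      simpa using norm_add_le (f y) (f x - f y)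
    linarith
  have h7 := intervalIntegral.integral_mono_on hx (intervalIntegrable_const (c := ‖f x‖))
    (hfi.add (intervalIntegrable_const (c := ∫ z in x..(x + 1), ‖deriv f z‖))) h3
  rw [intervalIntegral.integral_add hfi intervalIntegrable_const] at h7
  simp only [intervalIntegral.integral_const, add_sub_cancel_left, one_smul] at h7
  linarith

theorem h1Norm_univ_sq {f : ℝ → Vec} (hf : MemH1 f) :
    h1Norm univ f ^ 2 = l2Norm f ^ 2 + l2Norm (deriv f) ^ 2 := by
  rw [h1Norm, Real.sq_sqrt (by positivity), l2Norm_sq hf.memLp, l2Norm_sq hf.memLp_deriv,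
    setIntegral_univ, setIntegral_univ]

end L2Norm

/-! ### `H¹` as a Banach space -/

section H1Space

/-- The elements of `H¹(ℝ; ℝ²)` as a space of functions. -/
def h1Submodule : Submodule ℝ (ℝ → Vec) where
  carrier := {f | MemH1 f}
  add_mem' := fun hf hg => MemH1.add hf hg
  zero_mem' := IsPrimitive.memH1 (g := 0) ⟨locallyIntegrable_zero, by simp⟩ MemLp.zero MemLp.zero
  smul_mem' := fun r f hf => by
    have h := MemH1.clm_comp_add_right hf (r • ContinuousLinearMap.id ℝ Vec) 0
    simpa [Pi.smul_def] using h

/-- The Banach space `H¹(ℝ; ℝ²)`. -/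
def H1Space : Type := h1Submodule

namespace H1Space

instance : AddCommGroup H1Space := inferInstanceAs (AddCommGroup h1Submodule)

instance : Module ℝ H1Space := inferInstanceAs (Module ℝ h1Submodule)

/-- The underlying function of an element of `H¹`. -/
def toFun (f : H1Space) : ℝ → Vec := f.1

instance : CoeFun H1Space fun _ => ℝ → Vec := ⟨toFun⟩

/-- The element of `H¹` given by a function. -/
def mk (f : ℝ → Vec) (hf : MemH1 f) : H1Space := ⟨f, hf⟩

theorem memH1 (f : H1Space) : MemH1 f := f.2

theorem coe_injective {f g : H1Space} (h : (f : ℝ → Vec) = g) : f = g := Subtype.ext h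

@[ext]
theorem ext {f g : H1Space} (h : ∀ x, f x = g x) : f = g := Subtype.ext (funext h)

@[simp]
theorem mk_apply (f : ℝ → Vec) (hf : MemH1 f) (x : ℝ) : mk f hf x = f x := rfl

@[simp]
theorem add_apply (f g : H1Space) (x : ℝ) : (f + g) x = f x + g x := rfl

@[simp]
theorem sub_apply (f g : H1Space) (x : ℝ) : (f - g) x = f x - g x := rfl

@[simp]
theorem smul_apply (r : ℝ) (f : H1Space) (x : ℝ) : (r • f) x = r • f x := rfl

theorem deriv_add (f g : H1Space) :
    deriv (f + g : H1Space) =ᵐ[volume] fun x => deriv f x + deriv g x :=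
  (f.memH1.isPrimitive.add g.memH1.isPrimitive).deriv_ae_eq

theorem deriv_sub (f g : H1Space) :
    deriv (f - g : H1Space) =ᵐ[volume] fun x => deriv f x - deriv g x :=
  (f.memH1.isPrimitive.sub g.memH1.isPrimitive).deriv_ae_eq

theorem deriv_smul (r : ℝ) (f : H1Space) :
    deriv (r • f : H1Space) =ᵐ[volume] fun x => r • deriv f x := by
  have h := (f.memH1.isPrimitive.clm_comp (r • ContinuousLinearMap.id ℝ Vec)).deriv_ae_eq
  simpa using! h

/-- A function of `H¹` together with its weak derivative, in `L² × L²`. -/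
def toL2 : H1Space →ₗ[ℝ] Lp Vec 2 (volume : Measure ℝ) × Lp Vec 2 (volume : Measure ℝ) where
  toFun f := (f.memH1.memLp.toLp f, f.memH1.memLp_deriv.toLp (deriv f))
  map_add' f g := Prod.ext rfl (by
    rw [Prod.snd_add, ← MemLp.toLp_add]
    exact MemLp.toLp_congr (f + g).memH1.memLp_deriv _ (deriv_add f g))
  map_smul' r f := Prod.ext rfl (by
    rw [RingHom.id_apply, Prod.smul_snd, ← MemLp.toLp_const_smul]
    exact MemLp.toLp_congr (r • f).memH1.memLp_deriv _ (deriv_smul r f))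

theorem toL2_injective : Function.Injective toL2 := by
  intro f g h
  have h1 := (MemLp.toLp_eq_toLp_iff f.memH1.memLp g.memH1.memLp).mp (congrArg Prod.fst h)
  exact ext fun x => congrFun
    (Continuous.ae_eq_iff_eq volume f.memH1.continuous g.memH1.continuous |>.mp h1) x

instance : NormedAddCommGroup H1Space :=
  NormedAddCommGroup.induced H1Space _ toL2 toL2_injective

instance : NormedSpace ℝ H1Space := NormedSpace.induced ℝ H1Space _ toL2

/-- The norm is the maximum norm inherited from `L² × L²`, only equivalent to `h1Norm univ`. Passing
between the two costs a factor `2` in one direction. -/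
theorem norm_def (f : H1Space) : ‖f‖ = max (l2Norm f) (l2Norm (deriv f)) := by
  change max ‖f.memH1.memLp.toLp f‖ ‖f.memH1.memLp_deriv.toLp (deriv f)‖ = _
  rw [Lp.norm_toLp, Lp.norm_toLp]
  rfl

theorem isometry_toL2 : Isometry toL2 := AddMonoidHomClass.isometry_of_norm toL2 fun _ => rfl

theorem l2Norm_le (f : H1Space) : l2Norm f ≤ ‖f‖ := by
  rw [norm_def]
  exact le_max_left _ _

theorem l2Norm_deriv_le (f : H1Space) : l2Norm (deriv f) ≤ ‖f‖ := by
  rw [norm_def]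
  exact le_max_right _ _

theorem norm_apply_le (f : H1Space) (x : ℝ) : ‖f x‖ ≤ 2 * ‖f‖ :=
  (f.memH1.norm_apply_le x).trans (by linarith [l2Norm_le f, l2Norm_deriv_le f])

theorem norm_le_h1Norm (f : H1Space) : ‖f‖ ≤ h1Norm univ f := by
  have h := h1Norm_univ_sq f.memH1
  rw [norm_def]
  exact max_le (le_of_sq_le_sq (by nlinarith [sq_nonneg (l2Norm (deriv f))]) (Real.sqrt_nonneg _))
    (le_of_sq_le_sq (by nlinarith [sq_nonneg (l2Norm f)]) (Real.sqrt_nonneg _))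

theorem h1Norm_le_norm (f : H1Space) : h1Norm univ f ≤ 2 * ‖f‖ := by
  have h := h1Norm_univ_sq f.memH1
  have h1 := l2Norm_le f
  have h2 := l2Norm_deriv_le f
  have h3 := l2Norm_nonneg f
  have h4 := l2Norm_nonneg (deriv f)
  refine le_of_sq_le_sq ?_ (by positivity)
  nlinarith

/-- Evaluation at a point. -/
def eval (x : ℝ) : H1Space →L[ℝ] Vec :=
  LinearMap.mkContinuous
    { toFun := fun f => f x
      map_add' := fun _ _ => rfl
      map_smul' := fun _ _ => rfl } 2 fun f => norm_apply_le f x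

/-- The functions and their derivatives converge in `L²`, and the Sobolev embedding provides a
pointwise limit `f`. It remains to see that `f` represents the first `L²` limit and is a primitive
of the second. -/
instance : CompleteSpace H1Space := by
  refine Metric.complete_of_cauchySeq_tendsto fun u hu => ?_
  obtain ⟨⟨f₀, g⟩, hlim⟩ := cauchySeq_tendsto_of_complete
    (isometry_toL2.uniformContinuous.comp_cauchySeq hu)
  have hlim' : Tendsto (fun n => toL2 (u n)) atTop (𝓝 (f₀, g)) := hlim
  have hpt : ∀ x, ∃ y, Tendsto (fun n => u n x) atTop (𝓝 y) := fun x =>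
    cauchySeq_tendsto_of_complete ((eval x).uniformContinuous.comp_cauchySeq hu)
  choose f hf using hpt
  have h1 : Tendsto (fun n => (toL2 (u n)).1) atTop (𝓝 f₀) :=
    (continuous_fst.tendsto _).comp hlim'
  have h2 : Tendsto (fun n => (toL2 (u n)).2) atTop (𝓝 g) :=
    (continuous_snd.tendsto _).comp hlim'
  have hae : f =ᵐ[volume] f₀ := by
    obtain ⟨ns, hns, hconv⟩ := (tendstoInMeasure_of_tendsto_Lp h1).exists_seq_tendsto_ae
    have hall : ∀ᵐ x, ∀ n, (toL2 (u n)).1 x = u n x :=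
      ae_all_iff.mpr fun n => (u n).memH1.memLp.coeFn_toLp
    filter_upwards [hconv, hall] with x hx hx'
    simp_rw [hx'] at hx
    exact tendsto_nhds_unique ((hf x).comp hns.tendsto_atTop) hx
  have hprim : IsPrimitive f g := by
    refine IsPrimitive.of_zero ((Lp.memLp g).locallyIntegrable one_le_two) fun x => ?_
    have hg := intervalIntegrable_of_locallyIntegrable
      ((Lp.memLp g).locallyIntegrable one_le_two)
    -- Cauchy-Schwarz on the bounded interval lets the fundamental theorem of calculus pass to the
    -- `L²` limit of the derivatives.
    have hbound : ∀ n, ‖(u n x - u n 0) - ∫ y in (0 : ℝ)..x, g y‖ ≤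
        ‖(toL2 (u n)).2 - g‖ * |x| ^ (1 / 2 : ℝ) := by
      intro n
      have hd := (u n).memH1.isPrimitive.intervalIntegrable
      have hm : MemLp (fun y => deriv (u n) y - g y) 2 volume :=
        (u n).memH1.memLp_deriv.sub (Lp.memLp g)
      have hn : l2Norm (fun y => deriv (u n) y - g y) = ‖(toL2 (u n)).2 - g‖ := by
        rw [Lp.norm_def, l2Norm]
        congr 1
        refine eLpNorm_congr_ae ?_
        filter_upwards [Lp.coeFn_sub (toL2 (u n)).2 g, (u n).memH1.memLp_deriv.coeFn_toLp]
          with y h3 h4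
        rw [h3, Pi.sub_apply]
        exact congrArg (· - g y) h4.symm
      rw [(u n).memH1.integral_deriv, ← intervalIntegral.integral_sub (hd 0 x) (hg 0 x), ← hn]
      rcases le_total 0 x with hx | hx
      · refine (intervalIntegral.norm_integral_le_integral_norm hx).trans ?_
        have := setIntegral_norm_le_l2Norm hm hx
        rw [abs_of_nonneg hx]
        rwa [sub_zero] at this
      · rw [intervalIntegral.integral_symm, norm_neg]
        refine (intervalIntegral.norm_integral_le_integral_norm hx).trans ?_
        have := setIntegral_norm_le_l2Norm hm hx
        rwa [zero_sub, ← abs_of_nonpos hx] at this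
    have hz : Tendsto (fun n => ‖(toL2 (u n)).2 - g‖ * |x| ^ (1 / 2 : ℝ)) atTop (𝓝 0) := by
      simpa using (tendsto_iff_norm_sub_tendsto_zero.mp h2).mul_const (|x| ^ (1 / 2 : ℝ))
    exact tendsto_nhds_unique ((hf x).sub (hf 0))
      (tendsto_iff_norm_sub_tendsto_zero.mpr (squeeze_zero (fun _ => norm_nonneg _) hbound hz))
  have hmem : MemH1 f := hprim.memH1 ((Lp.memLp f₀).ae_eq hae.symm) (Lp.memLp g)
  refine ⟨mk f hmem, isometry_toL2.isUniformInducing.isInducing.tendsto_nhds_iff.mpr ?_⟩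
  have hfg : toL2 (mk f hmem) = (f₀, g) := by
    refine Prod.ext (Lp.ext ?_) (Lp.ext ?_)
    · exact hmem.memLp.coeFn_toLp.trans hae
    · exact hmem.memLp_deriv.coeFn_toLp.trans hprim.deriv_ae_eq
  rw [hfg]
  exact hlim'

end H1Space

end H1Space

/-! ### The transport group on `H¹` -/

section Transport

namespace H1Space

/-- Translation by `k` followed by the linear map `A` of the values. -/
def twist (A : Vec →L[ℝ] Vec) (k : ℝ) : H1Space →L[ℝ] H1Space :=
  LinearMap.mkContinuous
    { toFun := fun f => mk (fun x => A (f (x + k))) (f.memH1.clm_comp_add_right A k)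
      map_add' := fun f g => ext fun x => by simp
      map_smul' := fun r f => ext fun x => by simp } ‖A‖ fun f => by
    have hA : ∀ g : ℝ → Vec, MemLp g 2 volume → l2Norm (fun x => A (g (x + k))) ≤
        ‖A‖ * l2Norm g := by
      intro g hg
      have hg' : MemLp (fun x => g (x + k)) 2 volume :=
        hg.comp_measurePreserving (measurePreserving_add_right volume k)
      have h := (memLp_of_le_linear (norm_nonneg A) le_rfl le_rfl (A.comp_memLp' hg').1 hg' hg' hg'
        (Eventually.of_forall fun x => by simpa using A.le_opNorm (g (x + k)))).2
      simp only [zero_mul, add_zero, l2Norm_comp_add_right hg] at h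
      exact h
    rw [norm_def]
    refine max_le ((hA f f.memH1.memLp).trans (by gcongr; exact l2Norm_le f)) ?_
    refine (l2Norm_congr (f.memH1.deriv_clm_comp_add_right A k)).trans_le ?_
    exact (hA _ f.memH1.memLp_deriv).trans (by gcongr; exact l2Norm_deriv_le f)

@[simp]
theorem twist_apply (A : Vec →L[ℝ] Vec) (k : ℝ) (f : H1Space) (x : ℝ) :
    twist A k f x = A (f (x + k)) := rfl

theorem norm_twist_le (A : Vec →L[ℝ] Vec) (k : ℝ) : ‖twist A k‖ ≤ ‖A‖ :=
  LinearMap.mkContinuous_norm_le _ (norm_nonneg _) _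

/-- Translations are strongly continuous on `H¹`. -/
theorem continuous_twist_id (f : H1Space) :
    Continuous fun k => twist (ContinuousLinearMap.id ℝ Vec) k f := by
  refine isometry_toL2.isUniformInducing.isInducing.continuous_iff.mpr ?_
  have hg : Continuous fun k : ℝ => (⟨fun x => x + k, by fun_prop⟩ : C(ℝ, ℝ)) :=
    ContinuousMap.continuous_of_continuous_uncurry _ (by
      change Continuous fun p : ℝ × ℝ => p.2 + p.1
      fun_prop)
  have hm : ∀ k : ℝ, MeasurePreserving (⟨fun x => x + k, by fun_prop⟩ : C(ℝ, ℝ))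
      (volume : Measure ℝ) volume := fun k => measurePreserving_add_right volume k
  have hc : ∀ F : Lp Vec 2 (volume : Measure ℝ), Continuous fun k : ℝ =>
      Lp.compMeasurePreserving (⟨fun x => x + k, by fun_prop⟩ : C(ℝ, ℝ)) (hm k) F := fun F =>
    continuous_const.compMeasurePreservingLp hg hm ENNReal.ofNat_ne_top
  refine ((hc (toL2 f).1).prodMk (hc (toL2 f).2)).congr fun k => Prod.ext ?_ ?_
  · exact Lp.toLp_compMeasurePreserving f.memH1.memLp (hm k)
  · refine (Lp.toLp_compMeasurePreserving f.memH1.memLp_deriv (hm k)).trans ?_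
    exact MemLp.toLp_congr _ (twist _ k f).memH1.memLp_deriv
      (f.memH1.deriv_clm_comp_add_right (ContinuousLinearMap.id ℝ Vec) k).symm

theorem continuous_twist (A : Vec →L[ℝ] Vec) :
    Continuous fun p : ℝ × H1Space => twist A p.1 p.2 := by
  -- Strong continuity in `k` and the bound `1` on the operator norms, uniform in `k`, give joint
  -- continuity.
  have h : Continuous fun p : ℝ × H1Space => twist (ContinuousLinearMap.id ℝ Vec) p.1 p.2 := by
    refine (continuous_prod_of_continuous_lipschitzWith
      (fun p : H1Space × ℝ => twist (ContinuousLinearMap.id ℝ Vec) p.2 p.1) 1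
      continuous_twist_id fun k => ?_).comp continuous_swap
    exact (twist _ k).lipschitz.weaken
      ((norm_twist_le _ k).trans (ContinuousLinearMap.norm_id_le) : ‖twist _ k‖ ≤ (1 : NNReal))
  refine ((twist A 0).continuous.comp h).congr fun p => ext fun x => ?_
  simp

end H1Space

/-- The spectral projection of `!![c, 1; 1, c]` for the eigenvalue `c + 1`. -/
def projPlus : Vec →L[ℝ] Vec :=
  (((2 : ℝ)⁻¹ • (EuclideanSpace.proj (0 : Fin 2) + EuclideanSpace.proj (1 : Fin 2)) :
    Vec →L[ℝ] ℝ)).smulRight !₂[(1 : ℝ), 1]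

/-- The spectral projection of `!![c, 1; 1, c]` for the eigenvalue `c - 1`. -/
def projMinus : Vec →L[ℝ] Vec :=
  (((2 : ℝ)⁻¹ • (EuclideanSpace.proj (0 : Fin 2) - EuclideanSpace.proj (1 : Fin 2)) :
    Vec →L[ℝ] ℝ)).smulRight !₂[(1 : ℝ), -1]

theorem transport_eq (c t : ℝ) (f : ℝ → Vec) (x : ℝ) :
    transport c t f x = projPlus (f (x + (c + 1) * t)) + projMinus (f (x + (c - 1) * t)) := by
  simp only [transport, projPlus, projMinus, ContinuousLinearMap.smulRight_apply,
    smul_apply, add_apply, sub_apply, PiLp.proj_apply, smul_eq_mul]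
  congr 2 <;> ring

/-- A bound for the norms of the operators `T_c(t)` on `H¹`. -/
def transportBound : ℝ := ‖projPlus‖ + ‖projMinus‖

theorem transportBound_nonneg : 0 ≤ transportBound := by
  unfold transportBound
  positivity

/-- The group `T_c(t)` on `H¹`. -/
def transportH1 (c t : ℝ) : H1Space →L[ℝ] H1Space :=
  H1Space.twist projPlus ((c + 1) * t) + H1Space.twist projMinus ((c - 1) * t)

theorem transportH1_apply (c t : ℝ) (f : H1Space) (x : ℝ) :
    transportH1 c t f x = transport c t f x := (transport_eq c t f x).symm

theorem norm_transportH1_le (c t : ℝ) : ‖transportH1 c t‖ ≤ transportBound :=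
  (norm_add_le _ _).trans
    (add_le_add (H1Space.norm_twist_le _ _) (H1Space.norm_twist_le _ _))

theorem norm_transportH1_apply_le (c t : ℝ) (f : H1Space) :
    ‖transportH1 c t f‖ ≤ transportBound * ‖f‖ :=
  ContinuousLinearMap.le_of_opNorm_le _ (norm_transportH1_le c t) f

theorem continuous_transportH1 (c : ℝ) :
    Continuous fun p : ℝ × H1Space => transportH1 c p.1 p.2 := by
  have h : ∀ (A : Vec →L[ℝ] Vec) (a : ℝ),
      Continuous fun p : ℝ × H1Space => H1Space.twist A (a * p.1) p.2 := fun A a =>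
    (H1Space.continuous_twist A).comp (f := fun p : ℝ × H1Space => (a * p.1, p.2))
      ((continuous_fst.const_mul a).prodMk continuous_snd)
  exact (h projPlus (c + 1)).add (h projMinus (c - 1))

theorem coe_transportH1 (c t : ℝ) (f : H1Space) :
    (transportH1 c t f : ℝ → Vec) = transport c t f := funext fun x => transportH1_apply c t f x

theorem transportH1_add (c s t : ℝ) (f : H1Space) :
    transportH1 c (s + t) f = transportH1 c s (transportH1 c t f) := by
  refine H1Space.coe_injective ?_
  rw [coe_transportH1, coe_transportH1, coe_transportH1, transport_add]

end Transport

/-! ### Global Lipschitz bounds for the nonlinearity -/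

section Nonlinearity

/-- The rotation `(u, v) ↦ (v, -u)`. -/
def rotation : Vec →L[ℝ] Vec :=
  (EuclideanSpace.proj (1 : Fin 2) : Vec →L[ℝ] ℝ).smulRight !₂[(1 : ℝ), 0] -
    (EuclideanSpace.proj (0 : Fin 2) : Vec →L[ℝ] ℝ).smulRight !₂[(0 : ℝ), 1]

/-- The nonlinear term `(N(|z|²) v, -N(|z|²) u)`, `z = (u, v)`, of the system. -/
def nonlin (N : ℝ → ℝ) (z : Vec) : Vec := N (‖z‖ ^ 2) • rotation z

/-- Reduces every estimate of the perturbation term to Lipschitz and derivative bounds for the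
single map `nonlin N`. -/
theorem pertNonlin_eq (N : ℝ → ℝ) (a w : Vec) :
    pertNonlin N a w = nonlin N (a + w) - nonlin N a := by
  ext i
  fin_cases i <;> simp [pertNonlin, nonlin, rotation] <;> ring

variable {N : ℝ → ℝ}

theorem IsSaturable.contDiff_comp_norm_sq (hN : IsSaturable N) :
    ContDiff ℝ ∞ fun z : Vec => N (‖z‖ ^ 2) :=
  hN.smooth.comp_contDiff (contDiff_norm_sq ℝ) fun z => sq_nonneg ‖z‖

theorem IsSaturable.contDiff_nonlin (hN : IsSaturable N) : ContDiff ℝ ∞ (nonlin N) :=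
  hN.contDiff_comp_norm_sq.smul rotation.contDiff

/-- The derivative at `z` is `N (|z|²) J + 2 N' (|z|²) ⟨z, ·⟩ J z`. For large `|z|` the first term
is bounded since `N` has a limit, and the second is of size `|N' (|z|²)| |z|²`, bounded by the decay
of `N'`. The remaining ball is compact. -/
theorem IsSaturable.exists_norm_fderiv_le (hN : IsSaturable N) :
    ∃ L : NNReal, ∀ z, ‖fderiv ℝ (nonlin N) z‖₊ ≤ L := by
  obtain ⟨Ninf, -, hlim⟩ := hN.limit
  obtain ⟨C₁, hC₁, hdec⟩ := hN.deriv_decay.exists_nonneg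
  have hev : ∀ᶠ s : ℝ in atTop, ‖N s‖ ≤ ‖Ninf‖ + 1 ∧ ‖deriv N s‖ ≤ C₁ * ‖s⁻¹‖ ∧ 0 < s :=
    (hlim.norm.eventually_le_const (by linarith)).and (hdec.bound.and (eventually_gt_atTop 0))
  obtain ⟨S, hS⟩ := eventually_atTop.mp hev
  obtain ⟨C₂, hC₂⟩ := (isCompact_closedBall (0 : Vec) (max S 1)).exists_bound_of_continuousOn
    (hN.contDiff_nonlin.continuous_fderiv (by simp)).continuousOn
  suffices h : ∀ z, ‖fderiv ℝ (nonlin N) z‖ ≤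
      max C₂ ((‖Ninf‖ + 1) * ‖rotation‖ + 2 * C₁ * ‖rotation‖) from
    ⟨(max C₂ ((‖Ninf‖ + 1) * ‖rotation‖ + 2 * C₁ * ‖rotation‖)).toNNReal, fun z => by
      rw [← NNReal.coe_le_coe]
      exact (h z).trans (Real.le_coe_toNNReal _)⟩
  intro z
  rcases le_or_gt ‖z‖ (max S 1) with hz | hz
  · exact (hC₂ z (mem_closedBall_zero_iff.mpr hz)).trans (le_max_left _ _)
  · refine le_trans ?_ (le_max_right _ _)
    have hz1 : 1 < ‖z‖ := (le_max_right _ _).trans_lt hz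
    have hzS : S ≤ ‖z‖ ^ 2 := by nlinarith [(le_max_left S 1).trans_lt hz]
    obtain ⟨hb1, hb2, hpos⟩ := hS _ hzS
    have hd : HasDerivAt N (deriv N (‖z‖ ^ 2)) (‖z‖ ^ 2) :=
      ((hN.smooth.contDiffAt (Ici_mem_nhds hpos)).differentiableAt (by simp)).hasDerivAt
    have hn : HasFDerivAt (fun z : Vec => ‖z‖ ^ 2) (2 • innerSL ℝ z) z :=
      (hasStrictFDerivAt_norm_sq z).hasFDerivAt
    have hf := (hd.comp_hasFDerivAt z hn).smul rotation.hasFDerivAt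
    have hf' : HasFDerivAt (nonlin N) _ z := hf
    rw [hf'.fderiv]
    refine (norm_add_le _ _).trans (add_le_add ?_ ?_)
    · rw [norm_smul]
      gcongr
      exact hb1
    · rw [ContinuousLinearMap.norm_smulRight_apply, norm_smul, two_smul]
      have h1 : ‖innerSL ℝ z + innerSL ℝ z‖ ≤ 2 * ‖z‖ := by
        refine (norm_add_le _ _).trans_eq ?_
        rw [innerSL_apply_norm]
        ring
      rw [norm_inv, norm_pow, norm_norm] at hb2
      calc ‖deriv N (‖z‖ ^ 2)‖ * ‖innerSL ℝ z + innerSL ℝ z‖ * ‖rotation z‖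
          ≤ (C₁ * (‖z‖ ^ 2)⁻¹) * (2 * ‖z‖) * (‖rotation‖ * ‖z‖) := by
            gcongr
            exact rotation.le_opNorm z
        _ = 2 * C₁ * ‖rotation‖ := by field_simp

theorem IsSaturable.exists_lipschitzWith (hN : IsSaturable N) :
    ∃ L : NNReal, LipschitzWith L (nonlin N) := by
  obtain ⟨L, hL⟩ := hN.exists_norm_fderiv_le
  exact ⟨L, lipschitzWith_of_nnnorm_fderiv_le (hN.contDiff_nonlin.differentiable (by simp)) hL⟩

theorem IsSaturable.exists_lipschitzOnWith_fderiv (hN : IsSaturable N) (R : ℝ) :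
    ∃ K : NNReal, LipschitzOnWith K (fderiv ℝ (nonlin N)) (Metric.closedBall 0 R) :=
  (hN.contDiff_nonlin.fderiv_right (m := 1) (WithTop.coe_le_coe.2 le_top)).contDiffOn
    |>.exists_lipschitzOnWith one_ne_zero (convex_closedBall _ _) (isCompact_closedBall _ _)

/-- The derivative of the nonlinearity is Lipschitz at the points of a ball, with respect to
arbitrary increments. -/
theorem IsSaturable.exists_norm_fderiv_sub_le (hN : IsSaturable N) (β : ℝ) :
    ∃ C : ℝ, 0 ≤ C ∧ ∀ a w : Vec, ‖a‖ ≤ β →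
      ‖fderiv ℝ (nonlin N) (a + w) - fderiv ℝ (nonlin N) a‖ ≤ C * ‖w‖ := by
  obtain ⟨L, hL⟩ := hN.exists_norm_fderiv_le
  obtain ⟨K, hK⟩ := hN.exists_lipschitzOnWith_fderiv (β + 1)
  have hL' : ∀ z, ‖fderiv ℝ (nonlin N) z‖ ≤ L := hL
  -- If `‖w‖ ≤ 1`, both points lie in the ball of radius `β + 1`, where `K` serves. Otherwise the
  -- difference is at most `2 * L ≤ 2 * L * ‖w‖`.
  refine ⟨K + 2 * L, by positivity, fun a w ha => ?_⟩
  rcases le_total ‖w‖ 1 with hw | hw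
  · have h := hK.norm_sub_le (x := a + w) (y := a)
      (mem_closedBall_zero_iff.mpr ((norm_add_le _ _).trans (by linarith)))
      (mem_closedBall_zero_iff.mpr (by linarith))
    rw [add_sub_cancel_left] at h
    refine h.trans ?_
    gcongr
    linarith [L.coe_nonneg]
  · refine (norm_sub_le _ _).trans ?_
    have h1 := hL' (a + w)
    have h2 := hL' a
    have h3 := K.coe_nonneg
    have h4 := L.coe_nonneg
    nlinarith

end Nonlinearity

/-! ### The perturbation term as a map of `H¹` -/

section Background

/-- A background state: a bounded `C¹` function with bounded derivative. -/
structure IsBackground (b b' : ℝ → Vec) (β : ℝ) : Prop where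
  hasDerivAt : ∀ x, HasDerivAt b (b' x) x
  continuous_deriv : Continuous b'
  norm_le : ∀ x, ‖b x‖ ≤ β
  norm_deriv_le : ∀ x, ‖b' x‖ ≤ β

variable {N : ℝ → ℝ} {b b' : ℝ → Vec} {β : ℝ}

theorem IsPulse.continuous {c : ℝ} (hb : IsPulse N c b) : Continuous b :=
  continuous_iff_continuousAt.mpr fun x => (hb.profile x).continuousAt

/-- The limits at `±∞` and continuity bound the profile; its derivative is a continuous function of
the profile, hence bounded too. -/
theorem IsPulse.exists_isBackground {c : ℝ} (hN : IsSaturable N) (hb : IsPulse N c b) :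
    ∃ b' β, IsBackground b b' β := by
  obtain ⟨bm, bp, -, -, -, hm, hp⟩ := hb.heteroclinic
  obtain ⟨A, hA⟩ := eventually_atBot.mp (hm.norm.eventually_le_const (lt_add_one ‖bm‖))
  obtain ⟨B, hB⟩ := eventually_atTop.mp (hp.norm.eventually_le_const (lt_add_one ‖bp‖))
  obtain ⟨C, hC⟩ := (isCompact_Icc (a := A) (b := B)).exists_bound_of_continuousOn
    hb.continuous.continuousOn
  have hbd : ∃ β₀, ∀ x, ‖b x‖ ≤ β₀ := by
    refine ⟨max (max (‖bm‖ + 1) (‖bp‖ + 1)) C, fun x => ?_⟩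
    rcases le_total x A with h | h
    · exact (hA x h).trans ((le_max_left _ _).trans (le_max_left _ _))
    rcases le_total B x with h' | h'
    · exact (hB x h').trans ((le_max_right _ _).trans (le_max_left _ _))
    · exact (hC x ⟨h, h'⟩).trans (le_max_right _ _)
  obtain ⟨β₀, hβ₀⟩ := hbd
  have hQ : Continuous fun z : Vec =>
      (N (‖z‖ ^ 2) / (1 - c ^ 2)) • !₂[z 0 + c * z 1, -c * z 0 - z 1] := by
    refine (hN.contDiff_comp_norm_sq.continuous.div_const _).smul ?_
    refine (PiLp.continuous_toLp 2 _).comp (continuous_pi fun i => ?_)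
    fin_cases i
    · simp only [Fin.zero_eta, Matrix.cons_val_zero]
      fun_prop
    · simp only [Fin.mk_one, Matrix.cons_val_one, Matrix.cons_val_fin_one]
      fun_prop
  obtain ⟨M, hM⟩ := (isCompact_closedBall (0 : Vec) β₀).exists_bound_of_continuousOn
    hQ.continuousOn
  exact ⟨_, max β₀ M, hb.profile, hQ.comp hb.continuous,
    fun x => (hβ₀ x).trans (le_max_left _ _),
    fun x => (hM (b x) (mem_closedBall_zero_iff.mpr (hβ₀ x))).trans (le_max_right _ _)⟩

theorem IsBackground.isPrimitive_pertNonlin (hN : IsSaturable N) (hb : IsBackground b b' β)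
    (w : H1Space) : IsPrimitive (fun x => pertNonlin N (b x) (w x)) (fun x =>
      fderiv ℝ (nonlin N) (b x + w x) (b' x + deriv w x) - fderiv ℝ (nonlin N) (b x) (b' x)) := by
  obtain ⟨L, hL⟩ := hN.exists_lipschitzWith
  have hsm : ContDiff ℝ 1 (nonlin N) := hN.contDiff_nonlin.of_le (by simp)
  have h1 := IsPrimitive.of_hasDerivAt hb.hasDerivAt hb.continuous_deriv
  have h2 := (h1.add w.memH1.isPrimitive).comp_lipschitz hsm hL
  simpa only [pertNonlin_eq] using h2.sub (h1.comp_lipschitz hsm hL)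

/-- The nonlinear term maps `H¹` to `H¹` and has linear growth. -/
theorem IsBackground.exists_memH1_pertNonlin (hN : IsSaturable N) (hb : IsBackground b b' β) :
    ∃ K : ℝ, 0 < K ∧ ∀ w : H1Space, ∃ h : MemH1 (fun x => pertNonlin N (b x) (w x)),
      ‖H1Space.mk _ h‖ ≤ K * ‖w‖ := by
  obtain ⟨L, hL⟩ := hN.exists_lipschitzWith
  obtain ⟨C, hC0, hC⟩ := hN.exists_norm_fderiv_sub_le β
  have hβ : 0 ≤ β := (norm_nonneg _).trans (hb.norm_le 0)
  have hCβ : 0 ≤ C * β := mul_nonneg hC0 hβ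
  refine ⟨L + C * β + 1, by positivity, fun w => ?_⟩
  have hprim := hb.isPrimitive_pertNonlin hN w
  have h1 := memLp_of_le_linear L.coe_nonneg le_rfl le_rfl
    hprim.continuous.aestronglyMeasurable w.memH1.memLp w.memH1.memLp w.memH1.memLp
    (Eventually.of_forall fun x => by
      rw [pertNonlin_eq]
      simpa using hL.norm_sub_le (b x + w x) (b x))
  have h2 := memLp_of_le_linear L.coe_nonneg hCβ le_rfl
    hprim.locInt.aestronglyMeasurable w.memH1.memLp_deriv w.memH1.memLp w.memH1.memLp
    (Eventually.of_forall fun x => by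
      -- This splitting keeps the growth linear: the first term is at most `L * ‖w'‖`, and the
      -- second at most `C * ‖w‖ * β`, because only the bounded `b'` meets the difference of
      -- derivatives.
      have e : fderiv ℝ (nonlin N) (b x + w x) (b' x + deriv w x) -
          fderiv ℝ (nonlin N) (b x) (b' x) = fderiv ℝ (nonlin N) (b x + w x) (deriv w x) +
            (fderiv ℝ (nonlin N) (b x + w x) - fderiv ℝ (nonlin N) (b x)) (b' x) := by
        rw [map_add, sub_apply]
        abel
      rw [e, zero_mul, add_zero]
      refine (norm_add_le _ _).trans (add_le_add ?_ ?_)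
      · exact ContinuousLinearMap.le_of_opNorm_le _ (norm_fderiv_le_of_lipschitz ℝ hL) _
      · refine (ContinuousLinearMap.le_of_opNorm_le _ (hC (b x) (w x) (hb.norm_le x)) _).trans ?_
        calc C * ‖w x‖ * ‖b' x‖ ≤ C * ‖w x‖ * β := by
              gcongr
              exact hb.norm_deriv_le x
          _ = C * β * ‖w x‖ := by ring)
  refine ⟨hprim.memH1 h1.1 h2.1, ?_⟩
  have n1 := w.l2Norm_le
  have n2 := w.l2Norm_deriv_le
  have n3 := norm_nonneg w
  rw [H1Space.norm_def]
  refine max_le (h1.2.trans ?_) ((l2Norm_congr hprim.deriv_ae_eq).trans_le (h2.2.trans ?_))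
  · nlinarith [L.coe_nonneg]
  · nlinarith [L.coe_nonneg]

/-- The nonlinear term as a map of `H¹`. -/
def nonlinH1 (N : ℝ → ℝ) (b : ℝ → Vec)
    (h : ∀ w : H1Space, MemH1 (fun x => pertNonlin N (b x) (w x)))
    (w : H1Space) : H1Space := H1Space.mk _ (h w)

/-- The nonlinear term is Lipschitz on the balls of `H¹`. -/
theorem IsBackground.exists_lipschitzOnWith_nonlinH1 (hN : IsSaturable N)
    (hb : IsBackground b b' β) (h : ∀ w : H1Space, MemH1 (fun x => pertNonlin N (b x) (w x)))
    (R : ℝ) : ∃ K : NNReal, LipschitzOnWith K (nonlinH1 N b h) (Metric.closedBall 0 R) := by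
  obtain ⟨L, hL⟩ := hN.exists_lipschitzWith
  -- The Sobolev embedding has constant `2`, so `b + u` takes values in this ball when `‖u‖ ≤ R`.
  obtain ⟨K, hK⟩ := hN.exists_lipschitzOnWith_fderiv (β + 2 * R)
  have hβ : 0 ≤ β := (norm_nonneg _).trans (hb.norm_le 0)
  refine ⟨L + K * β.toNNReal + 2 * K * R.toNNReal, LipschitzOnWith.of_dist_le_mul ?_⟩
  intro v hv w hw
  rw [mem_closedBall_zero_iff] at hv hw
  have hR : 0 ≤ R := (norm_nonneg _).trans hv
  have hpv := hb.isPrimitive_pertNonlin hN v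
  have hpw := hb.isPrimitive_pertNonlin hN w
  have hvw : MemLp (fun x => v x - w x) 2 volume := (v - w).memH1.memLp
  have hvw' : MemLp (fun x => deriv v x - deriv w x) 2 volume :=
    v.memH1.memLp_deriv.sub w.memH1.memLp_deriv
  have hball : ∀ (u : H1Space) (x : ℝ), ‖u‖ ≤ R → b x + u x ∈
      Metric.closedBall (0 : Vec) (β + 2 * R) := fun u x hu => mem_closedBall_zero_iff.mpr
    ((norm_add_le _ _).trans (add_le_add (hb.norm_le x) ((u.norm_apply_le x).trans (by gcongr))))
  have h1 := memLp_of_le_linear L.coe_nonneg le_rfl le_rfl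
    (hpv.continuous.sub hpw.continuous).aestronglyMeasurable hvw hvw hvw
    (Eventually.of_forall fun x => by
      rw [Pi.sub_apply, pertNonlin_eq, pertNonlin_eq]
      simpa using hL.norm_sub_le (b x + v x) (b x + w x))
  have hKβ : 0 ≤ K * β := mul_nonneg K.coe_nonneg hβ
  have hKn : (0 : ℝ) ≤ K * (2 * ‖v - w‖) := by positivity
  have h2 := memLp_of_le_linear L.coe_nonneg hKβ hKn
    (hpv.locInt.sub hpw.locInt).aestronglyMeasurable hvw' hvw w.memH1.memLp_deriv
    (Eventually.of_forall fun x => by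
      -- The last of the three terms, where `deriv w` is only in `L²`, is estimated with the sup
      -- norm of `v - w`; this is why the Lipschitz constant depends on `R`.
      have e : fderiv ℝ (nonlin N) (b x + v x) (b' x + deriv v x) -
          fderiv ℝ (nonlin N) (b x) (b' x) - (fderiv ℝ (nonlin N) (b x + w x) (b' x + deriv w x) -
          fderiv ℝ (nonlin N) (b x) (b' x)) =
          fderiv ℝ (nonlin N) (b x + v x) (deriv v x - deriv w x) +
            (fderiv ℝ (nonlin N) (b x + v x) - fderiv ℝ (nonlin N) (b x + w x)) (b' x) +
            (fderiv ℝ (nonlin N) (b x + v x) - fderiv ℝ (nonlin N) (b x + w x)) (deriv w x) := by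
        simp only [map_add, map_sub, sub_apply]
        abel
      have hd := hK.norm_sub_le (hball v x hv) (hball w x hw)
      rw [add_sub_add_left_eq_sub] at hd
      rw [Pi.sub_apply, e]
      refine (norm_add₃_le).trans (add_le_add (add_le_add ?_ ?_) ?_)
      · exact ContinuousLinearMap.le_of_opNorm_le _ (norm_fderiv_le_of_lipschitz ℝ hL) _
      · refine (ContinuousLinearMap.le_of_opNorm_le _ hd _).trans ?_
        calc K * ‖v x - w x‖ * ‖b' x‖ ≤ K * ‖v x - w x‖ * β := by
              gcongr
              exact hb.norm_deriv_le x
          _ = K * β * ‖v x - w x‖ := by ring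
      · refine (ContinuousLinearMap.le_of_opNorm_le _ hd _).trans ?_
        gcongr
        exact (v - w).norm_apply_le x)
  have n1 : l2Norm (fun x => v x - w x) ≤ ‖v - w‖ := (v - w).l2Norm_le
  have n2 : l2Norm (fun x => deriv v x - deriv w x) ≤ ‖v - w‖ :=
    (l2Norm_congr (H1Space.deriv_sub v w)).symm.trans_le (v - w).l2Norm_deriv_le
  have n3 : l2Norm (deriv w) ≤ R := w.l2Norm_deriv_le.trans hw
  have n4 := norm_nonneg (v - w)
  have n5 := L.coe_nonneg
  have n6 := K.coe_nonneg
  rw [dist_eq_norm, dist_eq_norm, H1Space.norm_def]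
  push_cast
  rw [Real.coe_toNNReal _ hβ, Real.coe_toNNReal _ hR]
  have e1 : L * l2Norm (fun x => v x - w x) ≤ L * ‖v - w‖ := by gcongr
  refine max_le (h1.2.trans ?_) ?_
  · have : 0 ≤ (K * β + 2 * K * R) * ‖v - w‖ := by positivity
    linarith
  · have e2 : L * l2Norm (fun x => deriv v x - deriv w x) ≤ L * ‖v - w‖ := by gcongr
    have e3 : K * β * l2Norm (fun x => v x - w x) ≤ K * β * ‖v - w‖ := by gcongr
    have e4 : K * (2 * ‖v - w‖) * l2Norm (deriv w) ≤ K * (2 * ‖v - w‖) * R := by gcongr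
    refine (l2Norm_congr (hpv.sub hpw).deriv_ae_eq).trans_le (h2.2.trans ?_)
    linarith

end Background

/-! ### Global solutions of evolution equations of linear growth -/

section GlobalODE

variable {E : Type*} [NormedAddCommGroup E] [NormedSpace ℝ E] [CompleteSpace E]

/-- For a vector field of linear growth, the time of existence in the Picard-Lindelöf theorem does
not depend on the initial data. -/
theorem exists_local_of_linear_growth {Φ : ℝ → E → E} (hc : Continuous fun p : ℝ × E => Φ p.1 p.2)
    (hl : ∀ R : ℝ, ∃ L : NNReal, ∀ t, LipschitzOnWith L (Φ t) (Metric.closedBall 0 R))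
    {K : NNReal} (hK : 0 < K) (hg : ∀ t v, ‖Φ t v‖ ≤ K * ‖v‖) (t₀ : ℝ) (x : E) :
    ∃ α : ℝ → E, α t₀ = x ∧ ∀ t ∈ Icc t₀ (t₀ + 1 / (2 * K)),
      HasDerivWithinAt α (Φ t (α t)) (Icc t₀ (t₀ + 1 / (2 * K))) t := by
  have hτ : (0 : ℝ) < 1 / (2 * K) := by positivity
  obtain ⟨L, hL⟩ := hl (2 * ‖x‖ + 1)
  have hb : Metric.closedBall x ((‖x‖₊ + 1 : NNReal) : ℝ) ⊆
      Metric.closedBall 0 (2 * ‖x‖ + 1) := by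
    refine Metric.closedBall_subset_closedBall' ?_
    rw [dist_zero_right]
    push_cast
    linarith
  -- On the ball of radius `‖x‖ + 1` about `x` the field is at most `K * (2 * ‖x‖ + 1)`. In time `1
  -- / (2 * K)` a solution moves at most `‖x‖ + 1 / 2`, so it stays in that ball.
  have hpl : IsPicardLindelof Φ (tmin := t₀) (tmax := t₀ + 1 / (2 * K))
      ⟨t₀, left_mem_Icc.mpr (by linarith)⟩ x (‖x‖₊ + 1) 0 (K * (2 * ‖x‖₊ + 1)) L := by
    refine ⟨fun t _ => (hL t).mono hb, fun y _ => ?_, fun t _ y hy => ?_, ?_⟩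
    · exact (hc.comp (continuous_id.prodMk continuous_const)).continuousOn
    · refine (hg t y).trans ?_
      have := hb hy
      rw [mem_closedBall_zero_iff] at this
      push_cast
      gcongr
    · have h1 : max (t₀ + 1 / (2 * (K : ℝ)) - t₀) (t₀ - t₀) = 1 / (2 * K) := by
        rw [sub_self, add_sub_cancel_left, max_eq_left hτ.le]
      simp only [h1]
      push_cast
      have : (0 : ℝ) < K := hK
      have := norm_nonneg x
      field_simp
      linarith
  exact hpl.exists_eq_forall_mem_Icc_hasDerivWithinAt₀

/-- Global existence for vector fields of linear growth which are Lipschitz on balls, together with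
Grönwall's bound. -/
theorem exists_global_of_linear_growth {Φ : ℝ → E → E} (hc : Continuous fun p : ℝ × E => Φ p.1 p.2)
    (hl : ∀ R : ℝ, ∃ L : NNReal, ∀ t, LipschitzOnWith L (Φ t) (Metric.closedBall 0 R))
    {K : NNReal} (hK : 0 < K) (hg : ∀ t v, ‖Φ t v‖ ≤ K * ‖v‖) (x : E) :
    ∃ v : ℝ → E, ContinuousOn v (Ici 0) ∧ (∀ t, 0 ≤ t → v t = x + ∫ s in (0 : ℝ)..t, Φ s (v s)) ∧
      ∀ t, 0 ≤ t → ‖v t‖ ≤ ‖x‖ * Real.exp (K * t) := by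
  have hτ : (0 : ℝ) < 1 / (2 * K) := by positivity
  choose S hS0 hS using exists_local_of_linear_growth hc hl hK hg
  generalize (1 / (2 * K) : ℝ) = τ at hτ hS
  -- `y n` is the state at time `n * τ`; the global curve `v` follows the local solution started
  -- from the last such node.
  let y : ℕ → E := fun n => Nat.rec x (fun n z => S (n * τ) z (n * τ + τ)) n
  have hy : ∀ n : ℕ, y (n + 1) = S (n * τ) (y n) (n * τ + τ) := fun n => rfl
  let v : ℝ → E := fun t => S (⌊t / τ⌋₊ * τ) (y ⌊t / τ⌋₊) t
  have hfloor : ∀ (n : ℕ) (t : ℝ), t ∈ Ico (n * τ) (n * τ + τ) → ⌊t / τ⌋₊ = n := by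
    intro n t ht
    have h0 : 0 ≤ t := le_trans (by positivity) ht.1
    rw [Nat.floor_eq_iff (by positivity), le_div_iff₀ hτ, div_lt_iff₀ hτ]
    exact ⟨ht.1, by linarith [ht.2]⟩
  have hv : ∀ n : ℕ, EqOn v (S (n * τ) (y n)) (Icc (n * τ) (n * τ + τ)) := by
    intro n t ht
    rcases ht.2.lt_or_eq with hlt | heq
    · simp only [v, hfloor n t ⟨ht.1, hlt⟩]
    · have h1 : ⌊t / τ⌋₊ = n + 1 := hfloor (n + 1) t (by
        push_cast
        rw [heq]
        constructor <;> linarith)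
      have h2 : ((n + 1 : ℕ) : ℝ) * τ = n * τ + τ := by push_cast; ring
      simp only [v, h1]
      rw [hy n, heq, h2, hS0]
  have hcover : ∀ t : ℝ, 0 ≤ t → t ∈ Ico (⌊t / τ⌋₊ * τ) (⌊t / τ⌋₊ * τ + τ) := by
    intro t ht
    have h1 := Nat.floor_le (div_nonneg ht hτ.le)
    have h2 := Nat.lt_floor_add_one (t / τ)
    rw [le_div_iff₀ hτ] at h1
    rw [div_lt_iff₀ hτ] at h2
    exact ⟨h1, by linarith⟩
  -- Right derivatives suffice for both the integral equation and Grönwall's inequality, so the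
  -- one-sided pieces need not be matched to first order at the nodes.
  have hderiv : ∀ t, 0 ≤ t → HasDerivWithinAt v (Φ t (v t)) (Ici t) t := by
    intro t ht
    have hm := hcover t ht
    generalize ⌊t / τ⌋₊ = n at hm
    have h1 := (hS (n * τ) (y n) t (Ico_subset_Icc_self hm)).congr_of_mem (hv n)
      (Ico_subset_Icc_self hm)
    rw [← hv n (Ico_subset_Icc_self hm)] at h1
    exact h1.mono_of_mem_nhdsWithin (mem_of_superset (Icc_mem_nhdsGE_of_mem ⟨le_rfl, hm.2⟩)
      (Icc_subset_Icc_left hm.1))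
  have hcont : ContinuousOn v (Ici 0) := by
    have hfin : LocallyFinite fun n : ℕ => Icc (n * τ) (n * τ + τ) := by
      intro t
      refine ⟨Iio (t + 1), Iio_mem_nhds (by linarith), (finite_le_nat ⌈(t + 1) / τ⌉₊).subset ?_⟩
      rintro n ⟨z, hz, hz'⟩
      have h1 : (n : ℝ) ≤ (t + 1) / τ := by
        rw [le_div_iff₀ hτ]
        exact hz.1.trans (le_of_lt hz')
      exact_mod_cast h1.trans (Nat.le_ceil _)
    refine (hfin.continuousOn_iUnion (fun n => isClosed_Icc) fun n => ?_).mono fun t ht =>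
      mem_iUnion.mpr ⟨⌊t / τ⌋₊, Ico_subset_Icc_self (hcover t ht)⟩
    exact (continuousOn_congr (hv n)).mpr fun t ht => (hS _ _ t ht).continuousWithinAt
  have hv0 : v 0 = x := by
    have := hv 0 (x := 0) ⟨by simp, by simpa using hτ.le⟩
    rw [this]
    simpa using! hS0 0 (y 0)
  refine ⟨v, hcont, fun t ht => ?_, fun t ht => ?_⟩
  · have hsub : uIcc 0 t ⊆ Ici 0 := by
      rw [uIcc_of_le ht]
      exact Icc_subset_Ici_self
    have h1 := intervalIntegral.integral_eq_sub_of_hasDeriv_right (hcont.mono hsub)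
      (f' := fun s => Φ s (v s))
      (fun s hs => (hderiv s (by
        rw [min_eq_left ht] at hs
        exact hs.1.le)).mono Ioi_subset_Ici_self)
      (hc.comp_continuousOn (continuousOn_id.prodMk (hcont.mono hsub))).intervalIntegrable
    rw [h1, hv0]
    abel
  · have h1 := norm_le_gronwallBound_of_norm_deriv_right_le (δ := ‖x‖) (K := K) (ε := 0)
      (hcont.mono (Icc_subset_Ici_self : Icc 0 t ⊆ Ici 0)) (fun s hs => hderiv s hs.1) (by rw [hv0])
      (fun s _ => by simpa using hg s (v s)) t (right_mem_Icc.mpr ht)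
    simpa [gronwallBound_ε0] using h1

/-- Global mild solutions of `u' = A u + F u` for the generator `A` of a bounded strongly continuous
group `T` and a map `F` of linear growth which is Lipschitz on balls. -/
theorem exists_global_mild_of_linear_growth {T : ℝ → E →L[ℝ] E} {m : ℝ} (hm : 0 ≤ m)
    (hTc : Continuous fun p : ℝ × E => T p.1 p.2) (hT : ∀ t v, ‖T t v‖ ≤ m * ‖v‖)
    (hadd : ∀ s t v, T (s + t) v = T s (T t v)) {F : E → E}
    (hlip : ∀ R : ℝ, ∃ L : NNReal, LipschitzOnWith L F (Metric.closedBall 0 R)) {K₀ : ℝ}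
    (hK₀ : 0 ≤ K₀) (hgrow : ∀ v, ‖F v‖ ≤ K₀ * ‖v‖) :
    ∃ K : ℝ, 0 < K ∧ ∀ x : E, ∃ u : ℝ → E, ContinuousOn u (Ici 0) ∧
      (∀ t, 0 ≤ t → u t = T t x + ∫ s in (0 : ℝ)..t, T (t - s) (F (u s))) ∧
      ∀ t, 0 ≤ t → ‖u t‖ ≤ m * (‖x‖ * Real.exp (K * t)) := by
  have hFc : Continuous F := by
    refine continuous_iff_continuousAt.mpr fun w => ?_
    obtain ⟨L, hL⟩ := hlip (‖w‖ + 1)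
    exact hL.continuousOn.continuousAt (Metric.closedBall_mem_nhds_of_mem (by simp))
  -- The field of the equation for `v t = T (-t) (u t)`: conjugation by the group removes the
  -- unbounded generator.
  have hc : Continuous fun p : ℝ × E => T (-p.1) (F (T p.1 p.2)) :=
    hTc.comp (f := fun p : ℝ × E => (-p.1, F (T p.1 p.2)))
      ((continuous_fst.neg).prodMk (hFc.comp hTc))
  have hl : ∀ R : ℝ, ∃ L : NNReal, ∀ t, LipschitzOnWith L (fun v => T (-t) (F (T t v)))
      (Metric.closedBall 0 R) := by
    intro R
    obtain ⟨L, hL⟩ := hlip (m * R)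
    refine ⟨m.toNNReal * L * m.toNNReal, fun t => ?_⟩
    refine LipschitzOnWith.of_dist_le_mul fun v hv w hw => ?_
    have hball : ∀ w ∈ Metric.closedBall (0 : E) R,
        T t w ∈ Metric.closedBall (0 : E) (m * R) := by
      intro w hw
      rw [mem_closedBall_zero_iff] at hw ⊢
      exact (hT t w).trans (by gcongr)
    have h1 := hL.norm_sub_le (hball v hv) (hball w hw)
    rw [← map_sub] at h1
    rw [dist_eq_norm, dist_eq_norm, ← map_sub]
    push_cast
    rw [Real.coe_toNNReal _ hm]
    calc ‖T (-t) (F (T t v) - F (T t w))‖ ≤ m * (L * (m * ‖v - w‖)) := by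
          refine (hT _ _).trans ?_
          gcongr
          refine h1.trans ?_
          gcongr
          exact hT _ _
      _ = _ := by ring
  have hg : ∀ t v, ‖T (-t) (F (T t v))‖ ≤ ((m * K₀ * m + 1).toNNReal : ℝ) * ‖v‖ := by
    intro t v
    rw [Real.coe_toNNReal _ (by positivity)]
    calc ‖T (-t) (F (T t v))‖ ≤ m * (K₀ * (m * ‖v‖)) := by
          refine (hT _ _).trans ?_
          gcongr
          refine (hgrow _).trans ?_
          gcongr
          exact hT _ _
      _ ≤ _ := by linarith [norm_nonneg v]
  have hK : 0 < (m * K₀ * m + 1).toNNReal := Real.toNNReal_pos.mpr (by positivity)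
  refine ⟨((m * K₀ * m + 1).toNNReal : ℝ), hK, fun x => ?_⟩
  obtain ⟨v, hvc, hvi, hvb⟩ := exists_global_of_linear_growth hc hl hK hg x
  refine ⟨fun t => T t (v t), hTc.comp_continuousOn (continuousOn_id.prodMk hvc), fun t ht => ?_,
    fun t ht => (hT _ _).trans (by gcongr; exact hvb t ht)⟩
  have hint : IntervalIntegrable (fun s => T (-s) (F (T s (v s)))) volume 0 t := by
    refine ContinuousOn.intervalIntegrable (hc.comp_continuousOn (continuousOn_id.prodMk
      (hvc.mono ?_)))
    rw [uIcc_of_le ht]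
    exact Icc_subset_Ici_self
  have h1 := ContinuousLinearMap.intervalIntegral_comp_comm (T t) hint
  calc T t (v t) = T t x + T t (∫ s in (0 : ℝ)..t, T (-s) (F (T s (v s)))) := by
        rw [hvi t ht, map_add]
    _ = _ := by
        rw [← h1]
        congr 1
        refine intervalIntegral.integral_congr fun s _ => ?_
        simp only [sub_eq_add_neg, hadd]

end GlobalODE

/-! ### Existence, domain of dependence and uniqueness -/

section Mild

variable {N : ℝ → ℝ} {b b' : ℝ → Vec} {β c : ℝ}

/-- Evaluation is jointly continuous on `H¹(ℝ) × ℝ`. -/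
theorem H1Space.continuous_eval : Continuous fun p : H1Space × ℝ => p.1 p.2 :=
  continuous_prod_of_continuous_lipschitzWith _ 2 (fun f => f.memH1.continuous) fun x =>
    LipschitzWith.of_dist_le_mul fun f g => by
      rw [dist_eq_norm, dist_eq_norm]
      exact (f - g).norm_apply_le x

/-- A mild solution as a continuous curve in `H¹`. -/
theorem IsMildSolution.exists_curve {F : ℝ → ℝ → Vec → Vec} {B₀ : ℝ → Vec} {B : ℝ → ℝ → Vec}
    (hB : IsMildSolution c F B₀ B) : ∃ u : ℝ → H1Space, ContinuousOn u (Ici 0) ∧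
      ∀ t, 0 ≤ t → (u t : ℝ → Vec) = B t := by
  classical
  let u : ℝ → H1Space := fun t => if h : 0 ≤ t then H1Space.mk (B t) (hB.memH1 t h) else 0
  have hu : ∀ t, 0 ≤ t → (u t : ℝ → Vec) = B t := by
    intro t ht
    simp only [u, dif_pos ht]
    rfl
  refine ⟨u, fun t₀ ht₀ => ?_, hu⟩
  refine tendsto_iff_norm_sub_tendsto_zero.mpr (squeeze_zero' (Eventually.of_forall fun t =>
    norm_nonneg _) ?_ (hB.continuous_H1 t₀ ht₀))
  filter_upwards [self_mem_nhdsWithin] with t ht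
  refine (H1Space.norm_le_h1Norm _).trans_eq (congrArg (h1Norm univ) (funext fun x => ?_))
  rw [H1Space.sub_apply, hu t ht, hu t₀ ht₀]

/-- A continuous curve in `H¹` satisfying Duhamel's formula is a mild solution. -/
theorem IsMildSolution.of_curve {F : ℝ → ℝ → Vec → Vec} {B₀ : ℝ → Vec} {B : ℝ → ℝ → Vec}
    {u : ℝ → H1Space} (hu : ContinuousOn u (Ici 0)) (huB : ∀ t, 0 ≤ t → (u t : ℝ → Vec) = B t)
    (h : ∀ t : ℝ, 0 ≤ t → ∀ x : ℝ, B t x = transport c t B₀ x +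
      ∫ s in (0 : ℝ)..t, transport c (t - s) (fun z => F s z (B s z)) x) :
    IsMildSolution c F B₀ B := by
  refine ⟨fun t ht => huB t ht ▸ (u t).memH1, fun t₀ ht₀ => ?_, h⟩
  have h1 := (tendsto_iff_norm_sub_tendsto_zero.mp (hu t₀ ht₀)).const_mul 2
  rw [mul_zero] at h1
  refine squeeze_zero' (Eventually.of_forall fun t => Real.sqrt_nonneg _) ?_ h1
  filter_upwards [self_mem_nhdsWithin] with t ht
  rw [← huB t ht, ← huB t₀ ht₀]
  exact (u t - u t₀).h1Norm_le_norm

/-- Global existence, with an exponential bound. -/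
theorem IsBackground.exists_comovingSolution (hN : IsSaturable N) (hb : IsBackground b b' β)
    (c : ℝ) : ∃ K : ℝ, 0 < K ∧ ∃ C : ℝ, ∀ B₀ : ℝ → Vec, MemH1 B₀ →
      ∃ B : ℝ → ℝ → Vec, IsComovingSolution N c b B₀ B ∧
        ∀ t : ℝ, 0 ≤ t → h1Norm univ (B t) ≤ C * Real.exp (K * t) * h1Norm univ B₀ := by
  obtain ⟨K₀, hK₀, hF⟩ := hb.exists_memH1_pertNonlin hN
  choose hmem hgrow using hF
  have hlip := hb.exists_lipschitzOnWith_nonlinH1 hN hmem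
  obtain ⟨K, hK, H⟩ := exists_global_mild_of_linear_growth transportBound_nonneg
    (continuous_transportH1 c) (norm_transportH1_apply_le c) (transportH1_add c) hlip hK₀.le hgrow
  refine ⟨K, hK, 2 * transportBound, fun B₀ hB₀ => ?_⟩
  obtain ⟨u, huc, hui, hub⟩ := H (H1Space.mk B₀ hB₀)
  refine ⟨fun t => u t, IsMildSolution.of_curve huc (fun _ _ => rfl) fun t ht x => ?_,
    fun t ht => ?_⟩
  · have hint : IntervalIntegrable (fun s => transportH1 c (t - s) (nonlinH1 N b hmem (u s)))
        volume 0 t := by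
      have hu' : ContinuousOn u (uIcc 0 t) := huc.mono (by
        rw [uIcc_of_le ht]
        exact Icc_subset_Ici_self)
      have hFc : ContinuousOn (fun s => nonlinH1 N b hmem (u s)) (uIcc 0 t) := by
        obtain ⟨M, hM⟩ := isCompact_uIcc.exists_bound_of_continuousOn hu'
        obtain ⟨L, hL⟩ := hlip M
        exact hL.continuousOn.comp hu' fun s hs => mem_closedBall_zero_iff.mpr (hM s hs)
      exact ((continuous_transportH1 c).comp_continuousOn
        ((continuous_sub_left t).continuousOn.prodMk hFc)).intervalIntegrable
    -- Evaluation at `x` is continuous and linear on `H¹`, which turns the `H¹`-valued Duhamel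
    -- integral into the pointwise one.
    have h1 := ContinuousLinearMap.intervalIntegral_comp_comm (H1Space.eval x) hint
    have h2 := congrArg (H1Space.eval x) (hui t ht)
    rw [map_add, ← h1] at h2
    refine h2.trans (congrArg₂ (· + ·) (transportH1_apply c t _ x)
      (intervalIntegral.integral_congr fun s _ => ?_))
    exact transportH1_apply c (t - s) _ x
  · have h1 := (H1Space.mk B₀ hB₀).norm_le_h1Norm
    have h2 := transportBound_nonneg
    refine (H1Space.h1Norm_le_norm _).trans ?_
    calc 2 * ‖u t‖ ≤ 2 * (transportBound * (h1Norm univ B₀ * Real.exp (K * t))) := by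
          gcongr
          exact (hub t ht).trans (by gcongr; exact h1)
      _ = _ := by ring

/-- The difference of two transported functions. -/
theorem norm_transport_sub_le {f g : ℝ → Vec} {t x m : ℝ}
    (hp : ‖f (x + (c + 1) * t) - g (x + (c + 1) * t)‖ ≤ m)
    (hm : ‖f (x + (c - 1) * t) - g (x + (c - 1) * t)‖ ≤ m) :
    ‖transport c t f x - transport c t g x‖ ≤ transportBound * m := by
  rw [transport_eq, transport_eq, add_sub_add_comm, ← map_sub, ← map_sub, transportBound,
    add_mul ‖projPlus‖]
  exact (norm_add_le _ _).trans (add_le_add (projPlus.le_opNorm_of_le hp)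
    (projMinus.le_opNorm_of_le hm))

/-- Lipschitz bound for the integrand of Duhamel's formula, in terms of the domain of
dependence. -/
theorem norm_transport_pertNonlin_sub_le {L : NNReal} (hL : LipschitzWith L (nonlin N))
    {f g : ℝ → Vec} {ℓ m r s y : ℝ} (hs : s ≤ r) (hy : ℓ - (c - 1) * r ≤ y)
    (h : ∀ z, ℓ - (c - 1) * s ≤ z → ‖f z - g z‖ ≤ m) :
    ‖transport c (r - s) (fun z => pertNonlin N (b z) (f z)) y -
      transport c (r - s) (fun z => pertNonlin N (b z) (g z)) y‖ ≤ transportBound * (L * m) := by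
  have hpt : ∀ z, ℓ - (c - 1) * s ≤ z →
      ‖pertNonlin N (b z) (f z) - pertNonlin N (b z) (g z)‖ ≤ L * m := by
    intro z hz
    rw [pertNonlin_eq, pertNonlin_eq, sub_sub_sub_cancel_right]
    refine (hL.norm_sub_le _ _).trans ?_
    rw [add_sub_add_left_eq_sub]
    exact mul_le_mul_of_nonneg_left (h z hz) L.coe_nonneg
  -- The feet at time `s` of both characteristics through `(r, y)` stay in the region; the faster
  -- one lies farther right by `2 * (r - s)`.
  have e1 : ℓ - (c - 1) * s ≤ y + (c - 1) * (r - s) := by linarith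
  have e2 : ℓ - (c - 1) * s ≤ y + (c + 1) * (r - s) := by linarith
  exact norm_transport_sub_le (f := fun z => pertNonlin N (b z) (f z))
    (g := fun z => pertNonlin N (b z) (g z)) (hpt _ e2) (hpt _ e1)

/-- The integrand in Duhamel's formula is integrable. -/
theorem intervalIntegrable_duhamel (hN : IsSaturable N) (hb : Continuous b) {u : ℝ → H1Space}
    {B : ℝ → ℝ → Vec} (hu : ContinuousOn u (Ici 0)) (huB : ∀ t, 0 ≤ t → (u t : ℝ → Vec) = B t)
    {r : ℝ} (hr : 0 ≤ r) (y : ℝ) : IntervalIntegrable (fun s =>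
      transport c (r - s) (fun z => pertNonlin N (b z) (B s z)) y) volume 0 r := by
  have hcN : Continuous (nonlin N) := hN.contDiff_nonlin.continuous
  refine ContinuousOn.intervalIntegrable ?_
  rw [uIcc_of_le hr]
  have hterm : ∀ (A : Vec →L[ℝ] Vec) (a : ℝ), ContinuousOn (fun s =>
      A (pertNonlin N (b (y + a * (r - s))) (B s (y + a * (r - s))))) (Icc 0 r) := by
    intro A a
    have hy : Continuous fun s => y + a * (r - s) := by fun_prop
    have hpath : ContinuousOn (fun s => B s (y + a * (r - s))) (Icc 0 r) :=
      (H1Space.continuous_eval.comp_continuousOn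
        ((hu.mono Icc_subset_Ici_self).prodMk hy.continuousOn)).congr
          fun s hs => congrFun (huB s hs.1).symm _
    have hbp : ContinuousOn (fun s => b (y + a * (r - s))) (Icc 0 r) := (hb.comp hy).continuousOn
    simp_rw [pertNonlin_eq]
    exact A.continuous.comp_continuousOn
      ((hcN.comp_continuousOn (hbp.add hpath)).sub (hcN.comp_continuousOn hbp))
  simp_rw [transport_eq]
  exact (hterm projPlus (c + 1)).add (hterm projMinus (c - 1))

/-- Domain of dependence: the slowest characteristics in the comoving frame are those of speed
`c - 1` to the left, so data on `[ℓ, ∞)` determine the solution at time `t` on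
`[ℓ - (c - 1) t, ∞)`. -/
theorem IsComovingSolution.eq_of_eq_on_Ici (hN : IsSaturable N) (hb : Continuous b)
    {B₀ B₀' : ℝ → Vec} {B B' : ℝ → ℝ → Vec} (hB : IsComovingSolution N c b B₀ B)
    (hB' : IsComovingSolution N c b B₀' B') {ℓ : ℝ} (h0 : ∀ x, ℓ ≤ x → B₀ x = B₀' x)
    {t x : ℝ} (ht : 0 ≤ t) (hx : ℓ - (c - 1) * t ≤ x) : B t x = B' t x := by
  obtain ⟨L, hL⟩ := hN.exists_lipschitzWith
  obtain ⟨u, hu, huB⟩ := IsMildSolution.exists_curve hB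
  obtain ⟨u', hu', huB'⟩ := IsMildSolution.exists_curve hB'
  obtain ⟨M, hM⟩ := (isCompact_Icc (a := 0) (b := t)).exists_bound_of_continuousOn
    ((hu.sub hu').mono Icc_subset_Ici_self)
  -- Start from the sup bound `2 * M` and insert it in Duhamel's formula, where the linear parts
  -- cancel in this region. Each pass integrates one more power of time, and the factorial sends the
  -- bound to zero.
  have hiter : ∀ (n : ℕ), ∀ r ∈ Icc 0 t, ∀ y, ℓ - (c - 1) * r ≤ y →
      ‖B r y - B' r y‖ ≤ 2 * M * ((transportBound * L * r) ^ n / n.factorial) := by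
    intro n
    induction n with
    | zero =>
      intro r hr y _
      have h1 := (u r - u' r).norm_apply_le y
      rw [H1Space.sub_apply, huB r hr.1, huB' r hr.1] at h1
      have h2 : ‖u r - u' r‖ ≤ M := hM r hr
      simp only [pow_zero, Nat.factorial_zero, Nat.cast_one, div_one, mul_one]
      linarith
    | succ n ih =>
      intro r hr y hy
      have e1 : ℓ ≤ y + (c - 1) * r := by linarith
      have e2 : ℓ ≤ y + (c + 1) * r := by linarith [hr.1]
      have e0 : transport c r B₀ y = transport c r B₀' y := by
        rw [transport_eq, transport_eq, h0 _ e1, h0 _ e2]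
      have hbound : ∀ s ∈ Ioc 0 r, ‖transport c (r - s) (fun z => pertNonlin N (b z) (B s z)) y -
          transport c (r - s) (fun z => pertNonlin N (b z) (B' s z)) y‖ ≤
          (transportBound * L) ^ (n + 1) * (2 * M) / n.factorial * s ^ n := by
        intro s hs
        refine (norm_transport_pertNonlin_sub_le hL hs.2 hy
          (ih s ⟨hs.1.le, hs.2.trans hr.2⟩)).trans_eq ?_
        rw [mul_pow _ s]
        ring
      rw [hB.duhamel r hr.1, hB'.duhamel r hr.1, e0, add_sub_add_left_eq_sub,
        ← intervalIntegral.integral_sub (intervalIntegrable_duhamel hN hb hu huB hr.1 y)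
          (intervalIntegrable_duhamel hN hb hu' huB' hr.1 y)]
      refine (intervalIntegral.norm_integral_le_of_norm_le hr.1
        (Eventually.of_forall hbound) ((continuous_const.mul
          (continuous_pow n)).intervalIntegrable _ _)).trans_eq ?_
      rw [intervalIntegral.integral_const_mul, integral_pow, Nat.factorial_succ]
      push_cast
      field_simp
      ring
  have hlim : Tendsto (fun n : ℕ => 2 * M * ((transportBound * L * t) ^ n / n.factorial)) atTop
      (𝓝 0) := by
    simpa using (FloorSemiring.tendsto_pow_div_factorial_atTop
      (transportBound * (L : ℝ) * t)).const_mul (2 * M)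
  have hle := ge_of_tendsto' hlim fun n => hiter n t (right_mem_Icc.mpr ht) x hx
  exact sub_eq_zero.mp (norm_le_zero_iff.mp hle)

theorem IsComovingSolution.unique (hN : IsSaturable N) (hb : Continuous b)
    {B₀ : ℝ → Vec} {B B' : ℝ → ℝ → Vec} (hB : IsComovingSolution N c b B₀ B)
    (hB' : IsComovingSolution N c b B₀ B') {t : ℝ} (ht : 0 ≤ t) : B t = B' t :=
  funext fun x => hB.eq_of_eq_on_Ici hN hb hB' (ℓ := x + (c - 1) * t) (fun _ _ => rfl) ht
    (by linarith)

end Mild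

/-! ### Comoving and lab frames -/

section Frames

/-- Change to a moving frame. -/
theorem IsMildSolution.moving_frame {c : ℝ} {F : ℝ → ℝ → Vec → Vec} {B₀ : ℝ → Vec}
    {B : ℝ → ℝ → Vec} (hB : IsMildSolution c F B₀ B) (d : ℝ) :
    IsMildSolution (c - d) (fun t y w => F t (y - d * t) w) B₀ (fun t y => B t (y - d * t)) := by
  obtain ⟨u, hu, huB⟩ := hB.exists_curve
  refine IsMildSolution.of_curve
    (u := fun t => H1Space.twist (ContinuousLinearMap.id ℝ Vec) (-(d * t)) (u t)) ?_ ?_ ?_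
  · exact (H1Space.continuous_twist (ContinuousLinearMap.id ℝ Vec)).comp_continuousOn
      ((Continuous.continuousOn (f := fun t : ℝ => -(d * t)) (by fun_prop)).prodMk hu)
  · intro t ht
    funext y
    rw [H1Space.twist_apply, huB t ht, ContinuousLinearMap.id_apply, ← sub_eq_add_neg]
  · intro t ht y
    refine (hB.duhamel t ht (y - d * t)).trans (congrArg₂ (· + ·) ?_
      (intervalIntegral.integral_congr fun s _ => ?_))
    · have e1 : y - d * t + (c + 1) * t = y + (c - d + 1) * t := by ring
      have e2 : y - d * t + (c - 1) * t = y + (c - d - 1) * t := by ring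
      rw [transport_eq, transport_eq, e1, e2]
    · have e1 : y + (c - d + 1) * (t - s) - d * s = y - d * t + (c + 1) * (t - s) := by ring
      have e2 : y + (c - d - 1) * (t - s) - d * s = y - d * t + (c - 1) * (t - s) := by ring
      simp only [transport_eq, e1, e2]

theorem isComovingSolution_iff_isLabSolution (N : ℝ → ℝ) (c : ℝ) (b : ℝ → Vec) (B₀ : ℝ → Vec)
    (B : ℝ → ℝ → Vec) :
    IsComovingSolution N c b B₀ B ↔ IsLabSolution N c b B₀ (fun t y => B t (y - c * t)) := by
  constructor
  · intro h
    have h1 := IsMildSolution.moving_frame h c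
    rwa [sub_self] at h1
  · intro h
    -- The lab frame has transport parameter `0`, and moving with velocity `-c` restores `0 - (-c) =
    -- c`.
    have h1 := IsMildSolution.moving_frame h (-c)
    simpa only [neg_mul, sub_neg_eq_add, zero_add, add_sub_cancel_right] using! h1

theorem h1Norm_Ici_comp_sub (R k : ℝ) (f : ℝ → Vec) :
    h1Norm (Ici (R + k)) (fun y => f (y - k)) = h1Norm (Ici R) f := by
  have h : ∀ g : ℝ → ℝ, ∫ y in Ici (R + k), g (y - k) = ∫ x in Ici R, g x := by
    intro g
    have h1 := (measurePreserving_sub_right volume k).setIntegral_preimage_emb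
      (Homeomorph.subRight k).measurableEmbedding g (Ici R)
    rwa [show (fun x => x - k) ⁻¹' Ici R = Ici (R + k) by
      ext x
      simp] at h1
  simp only [h1Norm, deriv_comp_sub_const]
  rw [h fun x => ‖f x‖ ^ 2, h fun x => ‖deriv f x‖ ^ 2]

end Frames

/-! ### Extension from half-lines by even reflection -/

section Reflection

theorem h1Norm_nonneg (S : Set ℝ) (f : ℝ → Vec) : 0 ≤ h1Norm S f := Real.sqrt_nonneg _

theorem MemH1.h1Norm_le_univ {f : ℝ → Vec} (hf : MemH1 f) (S : Set ℝ) :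
    h1Norm S f ≤ h1Norm univ f := by
  rw [h1Norm, h1Norm, setIntegral_univ, setIntegral_univ]
  refine Real.sqrt_le_sqrt (add_le_add ?_ ?_)
  · exact setIntegral_le_integral (hf.memLp.integrable_norm_pow two_ne_zero)
      (Eventually.of_forall fun x => by positivity)
  · exact setIntegral_le_integral (hf.memLp_deriv.integrable_norm_pow two_ne_zero)
      (Eventually.of_forall fun x => by positivity)

theorem h1Norm_Ici_congr {f g : ℝ → Vec} {R : ℝ} (h : ∀ x, R ≤ x → f x = g x) :
    h1Norm (Ici R) f = h1Norm (Ici R) g := by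
  rw [h1Norm, h1Norm]
  congr 2
  · exact setIntegral_congr_fun measurableSet_Ici fun x hx => by simp only [h x hx]
  · rw [integral_Ici_eq_integral_Ioi, integral_Ici_eq_integral_Ioi]
    refine setIntegral_congr_fun measurableSet_Ioi fun x hx => ?_
    have h1 : f =ᶠ[𝓝 x] g := by
      filter_upwards [Ioi_mem_nhds hx] with y hy using h y (le_of_lt hy)
    simp only [h1.deriv_eq]

/-- The even reflection of an `H¹` function. -/
theorem MemH1.comp_abs {f : ℝ → Vec} (hf : MemH1 f) :
    MemH1 (fun x => f |x|) ∧ h1Norm univ (fun x => f |x|) = Real.sqrt 2 * h1Norm (Ici 0) f := by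
  have hprim := hf.isPrimitive.comp_abs
  have hneg : ∀ {g : ℝ → Vec}, MemLp g 2 volume → MemLp (fun x => g (-x)) 2 volume := fun hg =>
    hg.comp_measurePreserving (Measure.measurePreserving_neg volume)
  have hle : ∀ (p q : Vec), ‖p‖ ≤ 1 * ‖p‖ + 1 * ‖q‖ + 0 * ‖q‖ ∧
      ‖q‖ ≤ 1 * ‖p‖ + 1 * ‖q‖ + 0 * ‖q‖ := fun p q => by
    constructor <;> linarith [norm_nonneg p, norm_nonneg q]
  have h1 := (memLp_of_le_linear zero_le_one zero_le_one le_rfl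
    hprim.continuous.aestronglyMeasurable hf.memLp (hneg hf.memLp) (hneg hf.memLp)
    (Eventually.of_forall fun x => by
      rcases abs_choice x with h | h <;> rw [h]
      exacts [(hle _ _).1, (hle _ _).2])).1
  have h2 := (memLp_of_le_linear zero_le_one zero_le_one le_rfl
    hprim.locInt.aestronglyMeasurable hf.memLp_deriv (hneg hf.memLp_deriv) (hneg hf.memLp_deriv)
    (Eventually.of_forall fun x => by
      split_ifs
      · exact (hle _ _).1
      · rw [norm_neg]
        exact (hle _ _).2)).1
  refine ⟨hprim.memH1 h1 h2, ?_⟩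
  have e1 : ∫ x, ‖f |x|‖ ^ 2 = 2 * ∫ x in Ici (0 : ℝ), ‖f x‖ ^ 2 := by
    rw [integral_Ici_eq_integral_Ioi]
    exact integral_comp_abs (f := fun x => ‖f x‖ ^ 2)
  have e2 : ∫ x, ‖deriv (fun x => f |x|) x‖ ^ 2 = 2 * ∫ x in Ici (0 : ℝ), ‖deriv f x‖ ^ 2 := by
    rw [integral_Ici_eq_integral_Ioi, ← integral_comp_abs (f := fun x => ‖deriv f x‖ ^ 2)]
    refine integral_congr_ae (hprim.deriv_ae_eq.mono fun x hx => ?_)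
    simp only [hx]
    split_ifs with h
    · rw [abs_of_nonneg h]
    · rw [norm_neg, abs_of_neg (not_le.mp h)]
  rw [h1Norm, h1Norm, setIntegral_univ, setIntegral_univ, e1, e2, ← mul_add,
    Real.sqrt_mul zero_le_two]

/-- Extension of the restriction of an `H¹` function to a half-line. -/
theorem MemH1.exists_extension {f : ℝ → Vec} (hf : MemH1 f) (ℓ : ℝ) :
    ∃ g : ℝ → Vec, MemH1 g ∧ (∀ x, ℓ ≤ x → f x = g x) ∧
      h1Norm univ g ≤ Real.sqrt 2 * h1Norm (Ici ℓ) f := by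
  have htr : ∀ {h : ℝ → Vec} (k : ℝ), MemH1 h → MemH1 (fun x => h (x - k)) := fun k hh => by
    simpa only [ContinuousLinearMap.id_apply, ← sub_eq_add_neg] using
      hh.clm_comp_add_right (ContinuousLinearMap.id ℝ Vec) (-k)
  have h1 := (htr (-ℓ) hf).comp_abs
  -- Reflection about `ℓ`: shift `ℓ` to the origin, reflect evenly, shift back.
  refine ⟨fun x => f (|x - ℓ| - -ℓ), htr ℓ h1.1, fun x hx => ?_, ?_⟩
  · change f x = f (|x - ℓ| - -ℓ)
    rw [abs_of_nonneg (sub_nonneg.mpr hx)]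
    congr 1
    ring
  · have h2 : h1Norm univ (fun x => f (|x - ℓ| - -ℓ)) = h1Norm univ (fun x => f (|x| - -ℓ)) := by
      simp only [h1Norm, setIntegral_univ, deriv_comp_sub_const (fun x => f (|x| - -ℓ)) ℓ]
      congr 2
      · exact integral_sub_right_eq_self (fun x => ‖f (|x| - -ℓ)‖ ^ 2) ℓ
      · exact integral_sub_right_eq_self (fun x => ‖deriv (fun x => f (|x| - -ℓ)) x‖ ^ 2) ℓ
    have h3 := h1Norm_Ici_comp_sub ℓ (-ℓ) f
    rw [add_neg_cancel] at h3
    rw [h2, ← h3]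
    exact h1.2.le

end Reflection

/-! ### Convective stability -/

section Stability

variable {N : ℝ → ℝ} {b b' : ℝ → Vec} {β c : ℝ}

/-- Perturbations which decay fast enough ahead of the pulse are convected away. -/
theorem IsH1GrowthExponent.isBigO_comoving (hN : IsSaturable N) (hb : IsBackground b b' β)
    (hc : 1 < c) {γ₀ : ℝ} (hγ₀ : IsH1GrowthExponent N c b γ₀) {γ : ℝ} {B₀ : ℝ → Vec}
    (hB₀ : MemH1 B₀) (hdecay : (fun ℓ : ℝ => h1Norm (Ici ℓ) B₀) =O[atTop]
      (fun ℓ : ℝ => Real.exp (-γ * ℓ))) {B : ℝ → ℝ → Vec} (hB : IsComovingSolution N c b B₀ B)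
    (R : ℝ) : (fun t : ℝ => h1Norm (Ici R) (B t)) =O[atTop]
      (fun t : ℝ => Real.exp (-(γ * (c - 1) - γ₀) * t)) := by
  obtain ⟨C, hC⟩ := hγ₀
  obtain ⟨_, _, _, hex⟩ := hb.exists_comovingSolution hN c
  have hbc : Continuous b := continuous_iff_continuousAt.mpr fun x => (hb.hasDerivAt x).continuousAt
  have hbound : ∀ t, 0 ≤ t → h1Norm (Ici R) (B t) ≤
      |C| * Real.sqrt 2 * (Real.exp (γ₀ * t) * h1Norm (Ici (R + (c - 1) * t)) B₀) := by
    intro t ht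
    -- The cut point depends on `t`: its domain of influence at time `t` is exactly `[R, ∞)`. The
    -- constant of the growth exponent is uniform in the data, so `g` may vary with `t`.
    obtain ⟨g, hg, hfg, hgn⟩ := hB₀.exists_extension (R + (c - 1) * t)
    obtain ⟨D, hD, -⟩ := hex g hg
    have e : h1Norm (Ici R) (B t) = h1Norm (Ici R) (D t) := h1Norm_Ici_congr fun x hx =>
      hB.eq_of_eq_on_Ici hN hbc hD hfg ht (by linarith)
    calc h1Norm (Ici R) (B t) ≤ h1Norm univ (D t) := e.trans_le ((hD.memH1 t ht).h1Norm_le_univ _)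
      _ ≤ C * Real.exp (γ₀ * t) * h1Norm univ g := hC g D hg hD t ht
      _ ≤ |C| * Real.exp (γ₀ * t) * (Real.sqrt 2 * h1Norm (Ici (R + (c - 1) * t)) B₀) := by
          have := h1Norm_nonneg univ g
          gcongr
          exact le_abs_self C
      _ = _ := by ring
  have h1 : (fun t : ℝ => h1Norm (Ici R) (B t)) =O[atTop]
      fun t => Real.exp (γ₀ * t) * h1Norm (Ici (R + (c - 1) * t)) B₀ := by
    refine IsBigO.of_bound (|C| * Real.sqrt 2) ?_
    filter_upwards [eventually_ge_atTop 0] with t ht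
    rw [Real.norm_of_nonneg (h1Norm_nonneg _ _), Real.norm_of_nonneg
      (mul_nonneg (Real.exp_pos _).le (h1Norm_nonneg _ _))]
    exact hbound t ht
  have hℓ : Tendsto (fun t : ℝ => R + (c - 1) * t) atTop atTop :=
    tendsto_atTop_add_const_left _ _ (tendsto_id.const_mul_atTop (by linarith))
  have h2 := (isBigO_refl (fun t : ℝ => Real.exp (γ₀ * t)) atTop).mul (hdecay.comp_tendsto hℓ)
  -- The constant is what remains of `e^{-γ (R + (c - 1) t)}` once the dependence on `t` is split
  -- off.
  refine (h1.trans h2).trans (IsBigO.of_bound (Real.exp (-γ * R)) (Eventually.of_forall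
    fun t => ?_))
  rw [Function.comp_apply, ← Real.exp_add, Real.norm_of_nonneg (Real.exp_pos _).le,
    Real.norm_of_nonneg (Real.exp_pos _).le, ← Real.exp_add]
  exact (congrArg Real.exp (by ring)).le

end Stability

end ConvectiveStability

end

/-! ### The main theorem -/

open ConvectiveStability in
theorem mainTheorem1 (N : ℝ → ℝ) (hN : IsSaturable N) (c : ℝ) (hc : 1 < c) (b : ℝ → Vec)
    (hb : IsSupersonicPulse N c b) :
    -- the initial value problem has a unique global mild solution
    (∀ B₀ : ℝ → Vec, MemH1 B₀ →
      ∃ B : ℝ → ℝ → Vec, IsComovingSolution N c b B₀ B ∧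
        ∀ B' : ℝ → ℝ → Vec, IsComovingSolution N c b B₀ B' → ∀ t : ℝ, 0 ≤ t → B' t = B t) ∧
    -- the comoving and the lab formulation are equivalent
    (∀ (B₀ : ℝ → Vec) (B : ℝ → ℝ → Vec),
      (IsComovingSolution N c b B₀ B ↔ IsLabSolution N c b B₀ (fun t y => B t (y - c * t))) ∧
      ∀ R t : ℝ, h1Norm (Ici (R + c * t)) (fun y => B t (y - c * t)) = h1Norm (Ici R) (B t)) ∧
    -- there is a growth exponent, which depends on the nonlinearity and the pulse only
    (∃ γ₀ : ℝ, 0 < γ₀ ∧ IsH1GrowthExponent N c b γ₀) ∧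
    -- convective stability, for every growth exponent
    (∀ γ₀ : ℝ, 0 < γ₀ → IsH1GrowthExponent N c b γ₀ →
      ∀ γ : ℝ, γ₀ / (c - 1) < γ →
      ∀ B₀ : ℝ → Vec, MemH1 B₀ →
        (fun ℓ : ℝ => h1Norm (Ici ℓ) B₀) =o[atTop] (fun ℓ : ℝ => Real.exp (-γ * ℓ)) →
        (∀ B : ℝ → ℝ → Vec, IsLabSolution N c b B₀ B → ∀ R : ℝ,
          (fun t : ℝ => h1Norm (Ici (R + c * t)) (B t)) =O[atTop]
            (fun t : ℝ => Real.exp (-(γ * (c - 1) - γ₀) * t))) ∧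
        (∀ B : ℝ → ℝ → Vec, IsComovingSolution N c b B₀ B → ∀ R : ℝ,
          (fun t : ℝ => h1Norm (Ici R) (B t)) =O[atTop]
            (fun t : ℝ => Real.exp (-(γ * (c - 1) - γ₀) * t)))) := by
  obtain ⟨b', β, hbg⟩ := hb.toIsPulse.exists_isBackground hN
  have hbc := hb.toIsPulse.continuous
  obtain ⟨K, hK, C, hex⟩ := hbg.exists_comovingSolution hN c
  refine ⟨fun B₀ hB₀ => ?_, fun B₀ B => ⟨isComovingSolution_iff_isLabSolution N c b B₀ B,
    fun R t => h1Norm_Ici_comp_sub R (c * t) (B t)⟩, ⟨K, hK, C, fun B₀ B hB₀ hB t ht => ?_⟩,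
    fun γ₀ _ hγ₀ γ _ B₀ hB₀ hdecay => ⟨fun B hB R => ?_, fun B hB R =>
      hγ₀.isBigO_comoving hN hbg hc hB₀ hdecay.isBigO hB R⟩⟩
  · obtain ⟨B, hB, -⟩ := hex B₀ hB₀
    exact ⟨B, hB, fun B' hB' t ht => hB'.unique hN hbc hB ht⟩
  · obtain ⟨D, hD, hDn⟩ := hex B₀ hB₀
    -- A growth exponent must control every solution; uniqueness identifies it with the constructed
    -- one, which carries the bound.
    rw [hB.unique hN hbc hD ht]
    exact hDn t ht
  · have hlab : (fun t y => B t (y - c * t + c * t)) = B := by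
      simp only [sub_add_cancel]
    -- The lab estimate is the comoving one for the solution viewed from the pulse, since the
    -- half-line norms agree.
    have hcom : IsComovingSolution N c b B₀ (fun t x => B t (x + c * t)) := by
      rw [isComovingSolution_iff_isLabSolution, hlab]
      exact hB
    refine (hγ₀.isBigO_comoving hN hbg hc hB₀ hdecay.isBigO hcom R).congr_left fun t => ?_
    rw [← h1Norm_Ici_comp_sub R (c * t)]
    simp only [sub_add_cancel]
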